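/- Let $G$ be a finite simple connected graph. Write $\alpha(G)$ for its independence number (the largest size of a set of pairwise non-adjacent vertices) and $\kappa(G)$ for its vertex connectivity (the least number of vertices whose removal leaves a disconnected graph or a graph with at most one vertex). A 2-factor of $G$ is a spanning subgraph of $G$ in which every vertex has degree $2$. If $|V(G)| \ge 3\kappa(G)+3$, the minimum degree of $G$ is at least $2$, and $\alpha(G) \le \kappa(G)+1$, then $G$ has a 2-factor with at most two connected components. -/

import Mathlib

namespace SimpleGraph

/-- The (vertex) connectivity `κ(G)` of a finite simple graph `G`: the least number of vertices
whose removal leaves a disconnected graph or a graph with at most one vertex. For a complete graph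
on `n ≥ 1` vertices this is `n - 1`; for any other graph it is the least size of a vertex cut. -/
noncomputable def vertexConnectivity {V : Type*} (G : SimpleGraph V) : ℕ :=
  sInf {k : ℕ | ∃ S : Finset V, S.card = k ∧
    (¬ (G.induce ((S : Set V)ᶜ)).Preconnected ∨ ((S : Set V)ᶜ).Subsingleton)}

/-- `F` is a 2-factor of `G`: a spanning subgraph of `G` (a graph on the same vertex set, with
edges among those of `G`) in which every vertex has degree 2. -/
def IsTwoFactor {V : Type*} (G F : SimpleGraph V) : Prop :=
  F ≤ G ∧ ∀ v : V, (F.neighborSet v).ncard = 2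

end SimpleGraph

/-! Write `k` for the connectivity and suppose that neither one cycle nor two disjoint cycles cover
the vertices. Among all pairs of a longest cycle and a path-connected set `H` avoiding it, take one
with `H` as large as possible. The successors on the cycle of the attachments of `H`, together with
one vertex of `H`, are independent, since any edge would give a longer cycle. With the bound `k + 1`
on independent sets and `k`-connectivity, `H` has exactly `k` attachments and is a clique
(`LongestCycle.ncard_attach`, `LongestCycle.adj_of_mem`). A second component off the cycle would let
`H` grow (`LongestCycle.exists_larger`), so `H` is everything off the cycle. A clique on three or
more vertices carries a cycle, so `H` has at most two vertices and the cycle at least `3k + 1`.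

If `k = 1`, the degree condition leaves only a triangle formed by `H` and its attachment, and the
rest of the cycle is a clique. If `k ≥ 2`, any two attachments are joined by a path through all of
`H`, which is the setting of `Obstruction`. The attachments divide the cycle into arcs. Rerouting
arguments show that consecutive attachments are at distance at most 4 (`Obstruction.arc_le`), and
that a distance of 4 is followed by one of 2 (`Obstruction.next_arc_of_long`). So the average
distance is at most 3 and the cycle has at most `3k` vertices (`Obstruction.card_le`), a
contradiction. -/

namespace SimpleGraph

variable {V : Type*} {G : SimpleGraph V}

/-! ### Paths, connecting paths and cycles, recorded by their vertex sets -/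

/-- There is a path of `G` from `u` to `v` whose vertex set is exactly `S`. -/
def PathOn (G : SimpleGraph V) (u v : V) (S : Set V) : Prop :=
  ∃ l : List V, l.IsChain G.Adj ∧ l.Nodup ∧ l.head? = some u ∧ l.getLast? = some v ∧
    ∀ x, x ∈ l ↔ x ∈ S

/-- `x` and `y` have neighbours that are joined by a path with vertex set exactly `S`. -/
def Conn (G : SimpleGraph V) (x y : V) (S : Set V) : Prop :=
  ∃ u v, G.Adj x u ∧ PathOn G u v S ∧ G.Adj v y

/-- `c : ℤ → V` runs periodically around a cycle of `G` with `N` vertices. -/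
structure IsCyc (G : SimpleGraph V) (c : ℤ → V) (N : ℕ) : Prop where
  three_le : 3 ≤ N
  adj : ∀ n, G.Adj (c n) (c (n + 1))
  eq_iff : ∀ m n, c m = c n ↔ (N : ℤ) ∣ m - n

/-- `S` is the vertex set of a cycle of `G`. -/
def CycleOn (G : SimpleGraph V) (S : Set V) : Prop :=
  ∃ (c : ℤ → V) (N : ℕ), IsCyc G c N ∧ Set.range c = S

namespace PathOn

variable {u v x y : V} {S T : Set V}

lemma single (u : V) : PathOn G u u {u} := ⟨[u], by simp⟩

lemma symm (h : PathOn G u v S) : PathOn G v u S := by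
  obtain ⟨l, h1, h2, h3, h4, h5⟩ := h
  refine ⟨l.reverse, ?_, by simpa, by simpa, by simpa, by simpa⟩
  rw [List.isChain_reverse]
  exact h1.imp fun a b hab => hab.symm

lemma append (h : PathOn G u v S) (hvx : G.Adj v x) (h' : PathOn G x y T) (hd : Disjoint S T) :
    PathOn G u y (S ∪ T) := by
  obtain ⟨l, h1, h2, h3, h4, h5⟩ := h
  obtain ⟨l', h1', h2', h3', h4', h5'⟩ := h'
  refine ⟨l ++ l', ?_, ?_, ?_, ?_, ?_⟩
  · rw [List.isChain_append]
    refine ⟨h1, h1', ?_⟩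
    intro a ha b hb
    rw [h4] at ha; rw [h3'] at hb
    simp only [Option.mem_def, Option.some.injEq] at ha hb
    subst ha hb; exact hvx
  · rw [List.nodup_append]
    refine ⟨h2, h2', ?_⟩
    intro a ha b hb hab
    subst hab
    exact Set.disjoint_left.1 hd ((h5 a).1 ha) ((h5' a).1 hb)
  · simp [List.head?_append, h3]
  · simp [List.getLast?_append, h4']
  · intro a; simp [h5, h5']

lemma left_mem (h : PathOn G u v S) : u ∈ S := by
  obtain ⟨l, h1, h2, h3, h4, h5⟩ := h
  exact (h5 u).1 (List.mem_of_head? h3)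

lemma close (h : PathOn G u v S) (hvu : G.Adj v u)
    (h3 : ∃ x ∈ S, ∃ y ∈ S, ∃ z ∈ S, x ≠ y ∧ x ≠ z ∧ y ≠ z) : CycleOn G S := by
  obtain ⟨l, h1, h2, hh, hl, h5⟩ := h
  obtain ⟨x, hx, y, hy, z, hz, hxy, hxz, hyz⟩ := h3
  have hlen : 3 ≤ l.length := by
    have : [x, y, z].Subperm l := by
      apply List.subperm_of_subset
      · simp [hxy, hxz, hyz]
      · intro a ha
        simp only [List.mem_cons, List.not_mem_nil, or_false] at ha
        rcases ha with rfl | rfl | rfl <;> simpa [h5]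
    simpa using this.length_le
  have hpos : (0 : ℤ) < l.length := by omega
  have hmod : ∀ n : ℤ, (n % l.length).toNat < l.length := fun n => by
    have := Int.emod_lt_of_pos n hpos
    have := Int.emod_nonneg n hpos.ne'
    omega
  refine ⟨fun n => l[(n % l.length).toNat]'(hmod n), l.length, ⟨hlen, ?_, ?_⟩, ?_⟩
  · intro n
    have a1 := Int.emod_lt_of_pos n hpos
    have a2 := Int.emod_nonneg n hpos.ne'
    -- The wrap-around step uses the closing edge; every other step uses an edge of the path.
    rcases eq_or_ne (n % l.length) (l.length - 1) with he | he
    · have hn : (n + 1) % l.length = 0 := by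
        rw [Int.add_emod, he]
        have : (1 : ℤ) % l.length = 1 := Int.emod_eq_of_lt (by norm_num) (by omega)
        rw [this]; simp
      have e1 : l[(n % l.length).toNat]'(hmod n) = v := by
        rw [List.getLast?_eq_getElem?] at hl
        have : (n % l.length).toNat = l.length - 1 := by omega
        rw [List.getElem?_eq_getElem (by omega)] at hl
        simp only [Option.some.injEq] at hl
        rw [← hl]; congr 1
      have e2 : l[((n + 1) % l.length).toNat]'(hmod (n + 1)) = u := by
        rw [List.head?_eq_getElem?] at hh
        rw [List.getElem?_eq_getElem (by omega)] at hh
        simp only [Option.some.injEq] at hh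
        rw [← hh]; congr 1; rw [hn]; rfl
      rw [e1, e2]; exact hvu
    · have hn : (n + 1) % l.length = n % l.length + 1 := by
        rw [Int.add_emod]
        have : (1 : ℤ) % l.length = 1 := Int.emod_eq_of_lt (by norm_num) (by omega)
        rw [this]; exact Int.emod_eq_of_lt (by omega) (by omega)
      have := List.isChain_iff_getElem.1 h1 (n % l.length).toNat (by omega)
      convert this using 2
      rw [hn]; omega
  · intro m n
    rw [List.Nodup.getElem_inj_iff h2]
    have a2 := Int.emod_nonneg n hpos.ne'
    have a3 := Int.emod_nonneg m hpos.ne'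
    rw [Int.dvd_iff_emod_eq_zero, ← Int.emod_eq_emod_iff_emod_sub_eq_zero]
    omega
  · ext a
    simp only [Set.mem_range]
    rw [← h5]
    constructor
    · rintro ⟨n, rfl⟩; exact List.getElem_mem _
    · intro ha
      obtain ⟨i, hi, rfl⟩ := List.getElem_of_mem ha
      refine ⟨i, ?_⟩
      congr 1
      rw [Int.emod_eq_of_lt (by omega) (by omega)]; simp

end PathOn

namespace Conn

variable {u v x y : V} {S T : Set V}

lemma symm (h : Conn G x y S) : Conn G y x S := by
  obtain ⟨u, v, h1, h2, h3⟩ := h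
  exact ⟨v, u, h3.symm, h2.symm, h1.symm⟩

lemma nonempty (h : Conn G x y S) : S.Nonempty := by
  obtain ⟨u, v, h1, h2, h3⟩ := h
  exact ⟨u, h2.left_mem⟩

/-- Join two paths through a connecting path. -/
lemma glue {a b : V} {A B : Set V} (h : Conn G x y S) (hA : PathOn G a x A) (hB : PathOn G y b B)
    (h1 : Disjoint A S) (h2 : Disjoint A B) (h3 : Disjoint S B) : PathOn G a b (A ∪ S ∪ B) := by
  obtain ⟨u, v, hu, hS, hv⟩ := h
  exact (hA.append hu hS h1).append hv hB (Set.disjoint_union_left.2 ⟨h2, h3⟩)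

/-- Close a path to a cycle through a connecting path. -/
lemma close {A : Set V} (h : Conn G x y S) (hA : PathOn G y x A) (h1 : Disjoint A S)
    (h3 : ∃ a ∈ A, ∃ b ∈ A, a ≠ b) : CycleOn G (A ∪ S) := by
  obtain ⟨u, v, hu, hS, hv⟩ := h
  refine (hA.append hu hS h1).close hv ?_
  obtain ⟨a, ha, b, hb, hab⟩ := h3
  refine ⟨a, .inl ha, b, .inl hb, u, .inr hS.left_mem, hab, ?_, ?_⟩
  · rintro rfl; exact Set.disjoint_left.1 h1 ha hS.left_mem
  · rintro rfl; exact Set.disjoint_left.1 h1 hb hS.left_mem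

end Conn

/-! ### Cycles as periodic maps on the integers -/

namespace IsCyc

variable {c : ℤ → V} {N : ℕ}

lemma add_self (hc : IsCyc G c N) (n : ℤ) : c (n + N) = c n := (hc.eq_iff _ _).2 (by simp)

lemma ne_of_lt (hc : IsCyc G c N) {m n : ℤ} (h : m < n) (h' : n < m + N) : c m ≠ c n := by
  intro e
  have := Int.eq_zero_of_abs_lt_dvd ((hc.eq_iff _ _).1 e) (by rw [abs_lt]; omega)
  omega

lemma inj (hc : IsCyc G c N) {m n : ℤ} (e : c m = c n) (h : m < n + N) (h' : n < m + N) :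
    m = n := by
  have := Int.eq_zero_of_abs_lt_dvd ((hc.eq_iff _ _).1 e) (by rw [abs_lt]; omega)
  omega

/-- Picking the index in a prescribed window of length `N` turns cyclic order into linear
inequalities between integers. -/
lemma exists_rep (hc : IsCyc G c N) {v : V} (hv : v ∈ Set.range c) (i : ℤ) :
    ∃ n, i ≤ n ∧ n < i + N ∧ c n = v := by
  obtain ⟨m, rfl⟩ := hv
  have h3 := hc.three_le
  have hpos : (0 : ℤ) < N := by omega
  refine ⟨i + (m - i) % N, ?_, ?_, ?_⟩
  · have := Int.emod_nonneg (m - i) hpos.ne'; omega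
  · have := Int.emod_lt_of_pos (m - i) hpos; omega
  · rw [hc.eq_iff]
    have := Int.emod_add_mul_ediv (m - i) N
    exact ⟨-((m - i) / N), by linarith⟩

lemma rev (hc : IsCyc G c N) : IsCyc G (fun n => c (-n)) N where
  three_le := hc.three_le
  adj n := by
    have := (hc.adj (-(n + 1))).symm
    simpa using this
  eq_iff m n := by
    rw [hc.eq_iff, ← Int.dvd_neg]
    congr! 1; ring

lemma seg (hc : IsCyc G c N) {i j : ℤ} (hij : i ≤ j) (h : j < i + N) :
    PathOn G (c i) (c j) (c '' Set.Icc i j) := by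
  induction j, hij using Int.leInduction with
  | base => simpa using PathOn.single (G := G) (c i)
  | succ j hij ih =>
    have := (ih (by omega)).append (hc.adj j) (PathOn.single (c (j + 1))) (by
      rw [Set.disjoint_singleton_right]
      rintro ⟨m, ⟨hm1, hm2⟩, e⟩
      have := hc.inj e (by omega) (by omega)
      omega)
    convert this using 1
    rw [← Set.image_singleton, ← Set.image_union]
    congr 1
    ext m
    simp only [Set.mem_Icc, Set.mem_union, Set.mem_singleton_iff]
    omega

lemma disj (hc : IsCyc G c N) {i j k l : ℤ} (h : j < k) (h' : l < i + N) :
    Disjoint (c '' Set.Icc i j) (c '' Set.Icc k l) := by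
  rw [Set.disjoint_left]
  rintro _ ⟨m, ⟨hm1, hm2⟩, rfl⟩ ⟨n, ⟨hn1, hn2⟩, e⟩
  have := hc.inj e (by omega) (by omega)
  omega

lemma range_eq (hc : IsCyc G c N) (i : ℤ) : Set.range c = c '' Set.Icc i (i + N - 1) := by
  ext v
  constructor
  · intro hv
    obtain ⟨n, h1, h2, rfl⟩ := hc.exists_rep hv i
    exact ⟨n, ⟨h1, by omega⟩, rfl⟩
  · rintro ⟨n, -, rfl⟩; exact ⟨n, rfl⟩

lemma injOn (hc : IsCyc G c N) {i j : ℤ} (h : j < i + N) : Set.InjOn c (Set.Icc i j) := by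
  intro a ⟨ha1, ha2⟩ b ⟨hb1, hb2⟩ e
  exact hc.inj e (by omega) (by omega)

lemma ncard_image_Icc (hc : IsCyc G c N) {i j : ℤ} (h : j < i + N) :
    (c '' Set.Icc i j).ncard = (j + 1 - i).toNat := by
  rw [(hc.injOn h).ncard_image, Set.ncard_eq_toFinset_card']
  simp

lemma ncard_range (hc : IsCyc G c N) : (Set.range c).ncard = N := by
  rw [hc.range_eq 0, hc.ncard_image_Icc (by omega)]
  omega

end IsCyc

/-! ### Shifting along a cycle and absorbing an outside path -/

namespace IsCyc

variable {c : ℤ → V} {N : ℕ}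

lemma shift (hc : IsCyc G c N) {m n : ℤ} (e : c m = c n) (d : ℤ) : c (m + d) = c (n + d) := by
  rw [hc.eq_iff] at e ⊢
  simpa using e

/-- Indices of one vertex differ by multiples of `N`, so moving by `d` is well defined on vertices,
and moving back by `-d` undoes it. -/
lemma ncard_shift (hc : IsCyc G c N) {X : Set V} (hX : X ⊆ Set.range c) (d : ℤ) :
    {v | ∃ q, c q ∈ X ∧ c (q + d) = v}.ncard = X.ncard := by
  have hinv : ∀ n, c (Function.invFun c (c n)) = c n := fun n =>
    Function.invFun_eq ⟨n, rfl⟩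
  have hs : ∀ n, c (Function.invFun c (c n) + d) = c (n + d) := fun n => hc.shift (hinv n) d
  have : {v | ∃ q, c q ∈ X ∧ c (q + d) = v} = (fun v => c (Function.invFun c v + d)) '' X := by
    ext v
    constructor
    · rintro ⟨q, hq, rfl⟩; exact ⟨c q, hq, hs q⟩
    · rintro ⟨x, hx, rfl⟩
      obtain ⟨q, rfl⟩ := hX hx
      exact ⟨q, hx, (hs q).symm⟩
  rw [this]
  apply Set.InjOn.ncard_image
  intro x hx y hy e
  obtain ⟨q, rfl⟩ := hX hx
  obtain ⟨r, rfl⟩ := hX hy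
  simp only [hs] at e
  have := hc.shift e (-d)
  simpa using this

/-- Insertion of a connecting path between two consecutive vertices of a cycle. -/
lemma cycleOn_insert (hc : IsCyc G c N) {n : ℤ} {S : Set V} (hS : ∀ m, c m ∉ S)
    (h : Conn G (c n) (c (n + 1)) S) : CycleOn G (Set.range c ∪ S) := by
  have h3 := hc.three_le
  have e := hc.add_self n
  rw [hc.range_eq (n + 1)]
  have hseg := hc.seg (i := n + 1) (j := n + 1 + N - 1) (by omega) (by omega)
  have e' : c (n + 1 + N - 1) = c n := by rw [← e]; congr 1; ring
  rw [e'] at hseg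
  refine h.close hseg ?_ ⟨_, ⟨n + 1, ⟨le_rfl, by omega⟩, rfl⟩, _,
    ⟨n + 2, ⟨by omega, by omega⟩, rfl⟩, hc.ne_of_lt (by omega) (by omega)⟩
  rw [Set.disjoint_left]
  rintro _ ⟨m, -, rfl⟩
  exact hS m

/-- The crossing construction: two vertices joined by a connecting path, with adjacent
successors. -/
lemma cycleOn_cross (hc : IsCyc G c N) {p q : ℤ} (hpq : p < q) (hqp : q < p + N) {S : Set V}
    (hS : ∀ m, c m ∉ S) (h : Conn G (c q) (c p) S) (ha : G.Adj (c (q + 1)) (c (p + 1))) :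
    CycleOn G (Set.range c ∪ S) := by
  have h3 := hc.three_le
  have hS' : ∀ s : Set ℤ, Disjoint (c '' s) S := fun s => by
    rw [Set.disjoint_left]
    rintro _ ⟨m, -, rfl⟩
    exact hS m
  have s1 := hc.seg (i := p + 1) (j := q) (by omega) (by omega)
  have s2 := (hc.seg (i := q + 1) (j := p + N) (by omega) (by omega)).symm
  rw [hc.add_self] at s2
  have := (h.glue s1 s2 (hS' _) (hc.disj (by omega) (by omega)) (hS' _).symm).close ha ?_
  · convert this using 1
    rw [hc.range_eq (p + 1), Set.union_right_comm, ← Set.image_union]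
    congr 2
    ext m
    simp only [Set.mem_Icc, Set.mem_union]
    omega
  · obtain ⟨s, hs⟩ := h.nonempty
    refine ⟨c q, .inl (.inl ⟨q, ⟨by omega, le_rfl⟩, rfl⟩), s, .inl (.inr hs), c (q + 1),
      .inr ⟨q + 1, ⟨le_rfl, by omega⟩, rfl⟩, ?_, hc.ne_of_lt (by omega) (by omega), ?_⟩
    · rintro rfl; exact hS _ hs
    · rintro rfl; exact hS _ hs

end IsCyc

/-! ### Arcs between attachments when the cycle and `H` exhaust the graph -/

/-- A cycle `c` of `G` together with the set `H` of the remaining vertices, whose attachments on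
the cycle form the set `X`, in a graph that is neither Hamiltonian nor has a 2-factor with two
components, and whose independent sets have at most `|X| + 1` elements. -/
structure Obstruction (G : SimpleGraph V) (c : ℤ → V) (N : ℕ) (H X : Set V) : Prop where
  cyc : IsCyc G c N
  notMem : ∀ n, c n ∉ H
  cover : ∀ v, v ∈ H ∨ v ∈ Set.range c
  nonempty : H.Nonempty
  conn : ∀ x ∈ X, ∀ y ∈ X, x ≠ y → Conn G x y H
  nbr : ∀ h ∈ H, ∀ n, G.Adj h (c n) → c n ∈ X
  two : ∃ x ∈ X, ∃ y ∈ X, x ≠ y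
  sub : X ⊆ Set.range c
  not_two_cycles : ∀ S T, CycleOn G S → CycleOn G T → Disjoint S T → S ∪ T ≠ Set.univ
  not_hamiltonian : ¬ CycleOn G Set.univ
  indep : ∀ I : Set V, (∀ u ∈ I, ∀ v ∈ I, ¬ G.Adj u v) → I.ncard ≤ X.ncard + 1

namespace Obstruction

variable {c : ℤ → V} {N : ℕ} {H X : Set V}

/-- Reversing the orientation turns facts about successors into facts about predecessors. -/
lemma rev (h : Obstruction G c N H X) : Obstruction G (fun n => c (-n)) N H X where
  cyc := h.cyc.rev
  notMem n := h.notMem _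
  cover v := (h.cover v).imp id fun ⟨n, hn⟩ => ⟨-n, by simpa⟩
  nonempty := h.nonempty
  conn := h.conn
  nbr := fun a ha n => h.nbr a ha _
  two := h.two
  sub := fun x hx => by
    obtain ⟨n, hn⟩ := h.sub hx
    exact ⟨-n, by simpa⟩
  not_two_cycles := h.not_two_cycles
  not_hamiltonian := h.not_hamiltonian
  indep := h.indep

lemma disjH (h : Obstruction G c N H X) (s : Set ℤ) : Disjoint (c '' s) H := by
  rw [Set.disjoint_left]
  rintro _ ⟨m, -, rfl⟩
  exact h.notMem m

lemma range_union (h : Obstruction G c N H X) : Set.range c ∪ H = Set.univ :=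
  Set.eq_univ_of_forall fun v => (h.cover v).symm

lemma eq_univ (h : Obstruction G c N H X) (i : ℤ) {S : Set V}
    (hS : ∀ n, i ≤ n → n < i + N → c n ∈ S) (hH : H ⊆ S) : S = Set.univ := by
  refine Set.eq_univ_of_forall fun v => ?_
  rcases h.cover v with hv | hv
  · exact hH hv
  · obtain ⟨n, h1, h2, rfl⟩ := h.cyc.exists_rep hv i
    exact hS n h1 h2

/-- Otherwise the edge between two consecutive attachments could be replaced by a detour through all
of `H`, giving a Hamiltonian cycle. -/
lemma succ_notMem (h : Obstruction G c N H X) {n : ℤ} (hn : c n ∈ X) : c (n + 1) ∉ X := fun hn' =>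
  h.not_hamiltonian <| h.range_union ▸ h.cyc.cycleOn_insert h.notMem
    (h.conn _ hn _ hn' (h.cyc.adj n).ne)

lemma not_adj_succ (h : Obstruction G c N H X) {p q : ℤ} (hp : c p ∈ X) (hq : c q ∈ X) :
    ¬ G.Adj (c (p + 1)) (c (q + 1)) := by
  intro ha
  obtain ⟨r, h1, h2, h3⟩ := h.cyc.exists_rep ⟨q, rfl⟩ p
  have e := h.cyc.shift h3 1
  rw [← e] at ha; rw [← h3] at hq
  rcases h1.eq_or_lt with rfl | h1
  · exact ha.ne rfl
  exact h.not_hamiltonian <| h.range_union ▸ h.cyc.cycleOn_cross h1 h2 h.notMem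
    (h.conn _ hq _ hp (h.cyc.ne_of_lt h1 h2).symm) ha.symm

lemma not_adj_pred (h : Obstruction G c N H X) {p q : ℤ} (hp : c p ∈ X) (hq : c q ∈ X) :
    ¬ G.Adj (c (p - 1)) (c (q - 1)) := by
  have := h.rev.not_adj_succ (p := -p) (q := -q) (by simpa) (by simpa)
  simpa [sub_eq_add_neg, add_comm] using this

/-- Every vertex of the cycle outside the attachments and their successors is adjacent to the
successor of an attachment. -/
lemma exists_adj_succ [Finite V] (h : Obstruction G c N H X) (p : ℤ) {n : ℤ} (hn : c n ∉ X)
    (hn' : c (n - 1) ∉ X) : ∃ q, p ≤ q ∧ q < p + N ∧ c q ∈ X ∧ G.Adj (c n) (c (q + 1)) := by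
  by_contra! hcon
  have hcon' : ∀ q, c q ∈ X → ¬ G.Adj (c n) (c (q + 1)) := by
    intro q hq
    obtain ⟨r, h1, h2, h3⟩ := h.cyc.exists_rep ⟨q, rfl⟩ p
    rw [← h.cyc.shift h3 1]
    exact hcon r h1 h2 (h3 ▸ hq)
  obtain ⟨a, ha⟩ := h.nonempty
  set A := {v | ∃ q, c q ∈ X ∧ c (q + 1) = v} with hA
  have hAX : ∀ v ∈ A, ¬ G.Adj a v := by
    rintro v ⟨q, hq, rfl⟩ hav
    exact h.succ_notMem hq (h.nbr a ha _ hav)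
  have haA : a ∉ A := by rintro ⟨q, -, rfl⟩; exact h.notMem _ ha
  have hnA : c n ∉ insert a A := by
    rintro (e | ⟨q, hq, e⟩)
    · exact h.notMem n (e ▸ ha)
    · apply hn'
      have := h.cyc.shift e (-1)
      rw [sub_eq_add_neg, ← this]
      simpa using hq
  -- The successors of attachments, a vertex of `H` and `c n` would form an independent set of size
  -- `|X| + 2`.
  have := h.indep (insert (c n) (insert a A)) ?_
  · rw [Set.ncard_insert_of_notMem hnA, Set.ncard_insert_of_notMem haA,
      h.cyc.ncard_shift h.sub] at this
    omega
  · have key : ∀ v ∈ insert a A, ¬ G.Adj (c n) v := by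
      rintro v (rfl | ⟨q, hq, rfl⟩)
      · intro hv; exact hn (h.nbr _ ha _ hv.symm)
      · exact hcon' q hq
    rintro u (rfl | rfl | hu) v (rfl | rfl | hv)
    · exact G.loopless.irrefl _
    · exact key _ (.inl rfl)
    · exact key _ (.inr hv)
    · exact fun e => key _ (.inl rfl) e.symm
    · exact G.loopless.irrefl _
    · exact hAX v hv
    · exact fun e => key _ (.inr hu) e.symm
    · exact fun e => hAX u hu e.symm
    · obtain ⟨p, hp, rfl⟩ := hu
      obtain ⟨q, hq, rfl⟩ := hv
      exact h.not_adj_succ hp hq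

/-- The positions `p` and `m` on the cycle are consecutive attachments. -/
structure Next (c : ℤ → V) (N : ℕ) (X : Set V) (p m : ℤ) : Prop where
  left : c p ∈ X
  right : c m ∈ X
  lt : p < m
  lt' : m < p + N
  between : ∀ n, p < n → n < m → c n ∉ X

lemma exists_next (h : Obstruction G c N H X) {p : ℤ} (hp : c p ∈ X) : ∃ m, Next c N X p m := by
  classical
  have h3 := h.cyc.three_le
  -- The search from `p + 1` ends at the latest when it returns to `c p`; a second attachment makes
  -- it stop strictly earlier.
  have hex : ∃ d : ℕ, c (p + 1 + d) ∈ X := ⟨N - 1, by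
    have : p + 1 + ((N - 1 : ℕ) : ℤ) = p + N := by omega
    rw [this, h.cyc.add_self]; exact hp⟩
  refine ⟨p + 1 + Nat.find hex, hp, Nat.find_spec hex, by omega, ?_, ?_⟩
  · obtain ⟨y, hy, hne⟩ : ∃ y ∈ X, y ≠ c p := by
      obtain ⟨x, hx, y, hy, hxy⟩ := h.two
      by_cases e : x = c p
      · exact ⟨y, hy, fun e' => hxy (e.trans e'.symm)⟩
      · exact ⟨x, hx, e⟩
    obtain ⟨n, h1, h2, rfl⟩ := h.cyc.exists_rep (h.sub hy) p
    have : p ≠ n := by rintro rfl; exact hne rfl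
    have := Nat.find_min' hex (m := (n - p - 1).toNat) (by
      have : p + 1 + ((n - p - 1).toNat : ℤ) = n := by omega
      rwa [this])
    omega
  · intro n h1 h2 hn
    refine Nat.find_min hex (m := (n - p - 1).toNat) (by omega) ?_
    have : p + 1 + ((n - p - 1).toNat : ℤ) = n := by omega
    rwa [this]

lemma Next.rev {p m : ℤ} (h : Next c N X p m) : Next (fun n => c (-n)) N X (-m) (-p) where
  left := by simpa using h.right
  right := by simpa using h.left
  lt := by have := h.lt; omega
  lt' := by have := h.lt'; omega
  between n h1 h2 := h.between _ (by omega) (by omega)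

/-- The first vertex of an arc is adjacent to no vertex of the arc after the second one. -/
lemma not_adj_first [Finite V] (h : Obstruction G c N H X) {p m n : ℤ} (hm : Next c N X p m)
    (hn : p + 3 ≤ n) (hnm : n < m) : ¬ G.Adj (c (p + 1)) (c n) := by
  intro ha
  have hm' := hm.lt'
  have hm1 := hm.lt
  -- With `s` the farthest neighbour of the first vertex in the arc, the segment up to `s` closes to
  -- a cycle. It remains to put everything else, including `H`, on a second cycle.
  obtain ⟨s, ⟨hs1, hs2, hs3⟩, hmax⟩ := Int.exists_greatest_of_bdd
    (P := fun s => n ≤ s ∧ s < m ∧ G.Adj (c (p + 1)) (c s)) ⟨m, fun z hz => by omega⟩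
    ⟨n, le_rfl, hnm, ha⟩
  have hZ : CycleOn G (c '' Set.Icc (p + 1) s) :=
    (h.cyc.seg (by omega) (by omega)).close hs3.symm
      ⟨_, ⟨p + 1, ⟨by omega, by omega⟩, rfl⟩, _, ⟨p + 2, ⟨by omega, by omega⟩, rfl⟩, _,
        ⟨p + 3, ⟨by omega, by omega⟩, rfl⟩, h.cyc.ne_of_lt (by omega) (by omega),
        h.cyc.ne_of_lt (by omega) (by omega), h.cyc.ne_of_lt (by omega) (by omega)⟩
  rcases eq_or_ne (s + 1) m with rfl | hsm
  · have s1 := h.cyc.seg (i := s + 1) (j := p + N) (by omega) (by omega)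
    rw [h.cyc.add_self] at s1
    have C2 := (h.conn _ hm.left _ hm.right (h.cyc.ne_of_lt hm.lt hm.lt')).close s1 (h.disjH _)
      ⟨_, ⟨s + 1, ⟨by omega, by omega⟩, rfl⟩, _, ⟨p + N, ⟨by omega, by omega⟩, rfl⟩,
        h.cyc.ne_of_lt (by omega) (by omega)⟩
    refine h.not_two_cycles _ _ hZ C2 ?_ (h.eq_univ (p + 1) ?_ ?_)
    · rw [Set.disjoint_union_right]
      exact ⟨h.cyc.disj (by omega) (by omega), h.disjH _⟩
    · intro n h1 h2
      by_cases hn : n ≤ s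
      · exact .inl ⟨n, ⟨by omega, by omega⟩, rfl⟩
      · exact .inr (.inl ⟨n, ⟨by omega, by omega⟩, rfl⟩)
    · exact fun x hx => .inr (.inr hx)
  -- The next vertex `c (s + 1)` sees the successor of an attachment `q`, and `q ≠ p` by maximality
  -- of `s`. The second cycle runs from `s + 1` to `q`, through `H` to `p`, and backwards to `q +
  -- 1`.
  · obtain ⟨q, hq1, hq2, hq, hadj⟩ := h.exists_adj_succ p (n := s + 1)
      (hm.between _ (by omega) (by omega)) (hm.between _ (by omega) (by omega))
    have hqp : q ≠ p := by
      rintro rfl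
      have := hmax (s + 1) ⟨by omega, by omega, hadj.symm⟩
      omega
    have hqm : m ≤ q := by
      by_contra hlt
      exact hm.between q (by omega) (by omega) hq
    have s1 := h.cyc.seg (i := s + 1) (j := q) (by omega) (by omega)
    have s2 := (h.cyc.seg (i := q + 1) (j := p + N) (by omega) (by omega)).symm
    rw [h.cyc.add_self] at s2
    have C2 := ((h.conn _ hq _ hm.left (h.cyc.ne_of_lt (by omega) hq2).symm).glue s1 s2
      (h.disjH _) (h.cyc.disj (by omega) (by omega)) (h.disjH _).symm).close hadj.symm ?_
    · refine h.not_two_cycles _ _ hZ C2 ?_ (h.eq_univ (p + 1) ?_ ?_)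
      · rw [Set.disjoint_union_right, Set.disjoint_union_right]
        exact ⟨⟨h.cyc.disj (by omega) (by omega), h.disjH _⟩, h.cyc.disj (by omega) (by omega)⟩
      · intro n h1 h2
        by_cases hn : n ≤ s
        · exact .inl ⟨n, ⟨by omega, by omega⟩, rfl⟩
        · by_cases hn : n ≤ q
          · exact .inr (.inl (.inl ⟨n, ⟨by omega, by omega⟩, rfl⟩))
          · exact .inr (.inr ⟨n, ⟨by omega, by omega⟩, rfl⟩)
      · exact fun x hx => .inr (.inl (.inr hx))
    · exact ⟨_, .inl (.inl ⟨s + 1, ⟨by omega, by omega⟩, rfl⟩), _,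
        .inl (.inl ⟨m, ⟨by omega, by omega⟩, rfl⟩), _, .inr ⟨q + 1, ⟨by omega, by omega⟩, rfl⟩,
        h.cyc.ne_of_lt (by omega) (by omega), h.cyc.ne_of_lt (by omega) (by omega),
        h.cyc.ne_of_lt (by omega) (by omega)⟩

/-- Two covering cycles arise: the segment from `q + 1` around to `w`, closed by an edge; and the
one running from `w + 1` to `m`, through `H` to `q`, backwards to `m + 1` and back to `w + 1`. -/
lemma not_adj_consecutive_succ (h : Obstruction G c N H X) {p m w q : ℤ} (hm : Next c N X p m)
    (h1 : p < w) (h2 : w < m) (hq : c q ∈ X) (hq1 : m < q) (hq2 : q < p + N)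
    (ha : G.Adj (c w) (c (q + 1))) (hb : G.Adj (c (w + 1)) (c (m + 1))) : False := by
  -- Equality would make `q` and `p` consecutive attachments; excluding it gives the first cycle its
  -- three distinct vertices.
  have hqN : q + 1 ≠ p + N := by
    intro e
    refine h.succ_notMem hq ?_
    rw [e, h.cyc.add_self]; exact hm.left
  have s1 := h.cyc.seg (i := q + 1) (j := w + N) (by omega) (by omega)
  have C1 := s1.close (by rw [h.cyc.add_self]; exact ha)
    ⟨_, ⟨q + 1, ⟨by omega, by omega⟩, rfl⟩, _, ⟨p + N, ⟨by omega, by omega⟩, rfl⟩, _,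
      ⟨w + N, ⟨by omega, by omega⟩, rfl⟩, h.cyc.ne_of_lt (by omega) (by omega),
        h.cyc.ne_of_lt (by omega) (by omega), h.cyc.ne_of_lt (by omega) (by omega)⟩
  have s2 := h.cyc.seg (i := w + 1) (j := m) (by omega) (by omega)
  have s3 := (h.cyc.seg (i := m + 1) (j := q) (by omega) (by omega)).symm
  have cc := h.conn _ hm.right _ hq (h.cyc.ne_of_lt (by omega) (by omega))
  obtain ⟨a, haH⟩ := h.nonempty
  have C2 := (cc.glue s2 s3 (h.disjH _) (h.cyc.disj (by omega) (by omega))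
    (h.disjH _).symm).close hb.symm
    ⟨c m, .inl (.inl ⟨m, ⟨by omega, by omega⟩, rfl⟩), a, .inl (.inr haH), c q,
      .inr ⟨q, ⟨by omega, by omega⟩, rfl⟩, fun e => h.notMem _ (e ▸ haH),
      h.cyc.ne_of_lt (by omega) (by omega), fun e => h.notMem _ (e ▸ haH)⟩
  refine h.not_two_cycles _ _ C1 C2 ?_ (h.eq_univ (w + 1) ?_ ?_)
  · rw [Set.disjoint_union_right, Set.disjoint_union_right]
    exact ⟨⟨(h.cyc.disj (by omega) (by omega)).symm, h.disjH _⟩,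
      (h.cyc.disj (by omega) (by omega)).symm⟩
  · intro n h1 h2
    by_cases hn : n ≤ m
    · exact .inr (.inl (.inl ⟨n, ⟨by omega, by omega⟩, rfl⟩))
    · by_cases hn : n ≤ q
      · exact .inr (.inr ⟨n, ⟨by omega, by omega⟩, rfl⟩)
      · exact .inl ⟨n, ⟨by omega, by omega⟩, rfl⟩
  · exact fun x hx => .inr (.inl (.inr hx))

/-- The walk `q, …, w + 1, q + 1, …, p - 1, w, …, p`, closed through `H`, is a Hamiltonian cycle. -/
lemma not_adj_pred_and_succ (h : Obstruction G c N H X) {p m w q : ℤ} (hm : Next c N X p m)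
    (h1 : p < w) (h2 : w + 1 < m) (hq : c q ∈ X) (hq1 : m ≤ q) (hq2 : q < p + N)
    (ha : G.Adj (c w) (c (p - 1))) (hb : G.Adj (c (w + 1)) (c (q + 1))) : False := by
  have hqN : q + 1 ≠ p + N := by
    intro e
    refine h.succ_notMem hq ?_
    rw [e, h.cyc.add_self]; exact hm.left
  have s1 := (h.cyc.seg (i := w + 1) (j := q) (by omega) (by omega)).symm
  have s2 := h.cyc.seg (i := q + 1) (j := p - 1 + N) (by omega) (by omega)
  rw [h.cyc.add_self] at s2
  have s3 := (h.cyc.seg (i := p) (j := w) (by omega) (by omega)).symm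
  have d12 := h.cyc.disj (i := w + 1) (j := q) (k := q + 1) (l := p - 1 + N) (by omega) (by omega)
  have d31 := h.cyc.disj (i := p) (j := w) (k := w + 1) (l := q) (by omega) (by omega)
  have d32 := h.cyc.disj (i := p) (j := w) (k := q + 1) (l := p - 1 + N) (by omega) (by omega)
  have s := (s1.append hb s2 d12).append ha.symm s3
    (Set.disjoint_union_left.2 ⟨d31.symm, d32.symm⟩)
  have C := (h.conn _ hm.left _ hq (h.cyc.ne_of_lt (by omega) (by omega))).close s
    (Set.disjoint_union_left.2 ⟨Set.disjoint_union_left.2 ⟨h.disjH _, h.disjH _⟩, h.disjH _⟩)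
    ⟨_, .inr ⟨p, ⟨by omega, by omega⟩, rfl⟩, _, .inr ⟨w, ⟨by omega, by omega⟩, rfl⟩,
      h.cyc.ne_of_lt (by omega) (by omega)⟩
  refine h.not_hamiltonian ?_
  convert C using 1
  refine (h.eq_univ p ?_ ?_).symm
  · intro n h1 h2
    by_cases hn : n ≤ w
    · exact .inl (.inr ⟨n, ⟨by omega, by omega⟩, rfl⟩)
    · by_cases hn : n ≤ q
      · exact .inl (.inl (.inl ⟨n, ⟨by omega, by omega⟩, rfl⟩))
      · exact .inl (.inl (.inr ⟨n, ⟨by omega, by omega⟩, rfl⟩))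
  · exact fun x hx => .inr hx

/-- A vertex from the third one of an arc on is adjacent to the first vertex of the next arc, and
to no other first vertex of an arc. -/
lemma adj_next_first [Finite V] (h : Obstruction G c N H X) {p m n : ℤ} (hm : Next c N X p m)
    (hn : p + 3 ≤ n) (hnm : n < m) : G.Adj (c n) (c (m + 1)) ∧
      ∀ q, p ≤ q → q < p + N → c q ∈ X → G.Adj (c n) (c (q + 1)) → q = m := by
  have step : ∀ n, p + 3 ≤ n → n < m → G.Adj (c (n + 1)) (c (m + 1)) →
      G.Adj (c n) (c (m + 1)) ∧
        ∀ q, p ≤ q → q < p + N → c q ∈ X → G.Adj (c n) (c (q + 1)) → q = m := by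
    intro n hn hnm hb
    have uniq : ∀ q, p ≤ q → q < p + N → c q ∈ X → G.Adj (c n) (c (q + 1)) → q = m := by
      intro q hq1 hq2 hq ha
      by_contra hne
      have hqp : q ≠ p := by
        rintro rfl; exact h.not_adj_first hm hn hnm ha.symm
      have hqm : m ≤ q := by
        by_contra hlt
        exact hm.between q (by omega) (by omega) hq
      exact h.not_adj_consecutive_succ hm (by omega) hnm hq (by omega) hq2 ha hb
    obtain ⟨q, hq1, hq2, hq, ha⟩ := h.exists_adj_succ p (n := n)
      (hm.between _ (by omega) (by omega)) (hm.between _ (by omega) (by omega))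
    exact ⟨uniq q hq1 hq2 hq ha ▸ ha, uniq⟩
  -- The adjacency to `c (m + 1)` is propagated backwards along the arc, starting from the cycle
  -- edge at `c m`.
  have main : ∀ d : ℕ, ∀ n, p + 3 ≤ n → n + 1 + d = m → G.Adj (c (n + 1)) (c (m + 1)) := by
    intro d
    induction d with
    | zero =>
      intro n _ hnm
      rw [show n + 1 = m by omega]; exact h.cyc.adj m
    | succ d ih =>
      intro n hn hnm
      push_cast at hnm
      exact (step (n + 1) (by omega) (by omega) (ih (n + 1) (by omega) (by omega))).1
  exact step n hn hnm (main (m - n - 1).toNat n hn (by omega))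

lemma adj_prev_last [Finite V] (h : Obstruction G c N H X) {p m n : ℤ} (hm : Next c N X p m)
    (hn : p < n) (hnm : n + 3 ≤ m) : G.Adj (c n) (c (p - 1)) := by
  have := (h.rev.adj_next_first hm.rev (n := -n) (by omega) (by omega)).1
  simpa [sub_eq_add_neg, add_comm] using this

/-- In a longer arc, `c (p + 2)` is early enough to see `c (p - 1)` and `c (p + 3)` late enough to
see `c (m + 1)`, which `not_adj_pred_and_succ` forbids. -/
lemma arc_le [Finite V] (h : Obstruction G c N H X) {p m : ℤ} (hm : Next c N X p m) :
    m ≤ p + 4 := by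
  by_contra! hlt
  have h1 := h.adj_prev_last hm (n := p + 2) (by omega) (by omega)
  have h2 := (h.adj_next_first hm (n := p + 3) (by omega) (by omega)).1
  refine h.not_adj_pred_and_succ hm (w := p + 2) (by omega) (by omega) hm.right le_rfl hm.lt' h1 ?_
  rw [show p + 2 + 1 = p + 3 by ring]; exact h2

/-- Otherwise `c (p + 3)`, `c (m + 2)`, a vertex of `H` and all successors of attachments except `c
(m + 1)` would be `|X| + 2` independent vertices. -/
lemma next_arc_of_long [Finite V] (h : Obstruction G c N H X) {p m : ℤ} (hm : Next c N X p m)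
    (hpm : m = p + 4) : c (m + 2) ∈ X := by
  by_contra hX2
  have hN := hm.lt'
  have hX1 : c (m + 1) ∉ X := h.succ_notMem hm.right
  obtain ⟨m', hm'⟩ := h.exists_next hm.right
  have hmm' : m + 3 ≤ m' := by
    have h1 : m' ≠ m + 1 := by rintro rfl; exact hX1 hm'.right
    have h2 : m' ≠ m + 2 := by rintro rfl; exact hX2 hm'.right
    have := hm'.lt
    omega
  have hN' := hm'.lt'
  obtain ⟨h31, uniq⟩ := h.adj_next_first hm (n := p + 3) le_rfl (by omega)
  have hp2 : c (p + 2) ∉ X := hm.between _ (by omega) (by omega)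
  have hp3 : c (p + 3) ∉ X := hm.between _ (by omega) (by omega)
  obtain ⟨a, ha⟩ := h.nonempty
  set A := {v | ∃ q, c q ∈ X ∧ c (q + 1) = v} with hA
  set B := A \ {c (m + 1)} with hB
  have hAcard : A.ncard = X.ncard := h.cyc.ncard_shift h.sub 1
  have hBcard : B.ncard + 1 = X.ncard := by
    rw [← hAcard]
    exact Set.ncard_sdiff_singleton_add_one ⟨m, hm.right, rfl⟩
  have hpre : ∀ n, c (n - 1) ∉ X → c n ∉ A := by
    rintro n hn ⟨q, hq, e⟩
    have := h.cyc.shift e (-1)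
    rw [add_neg_cancel_right] at this
    exact hn (by rw [sub_eq_add_neg, ← this]; exact hq)
  have h3A : c (p + 3) ∉ B := fun e => hpre (p + 3) (by rwa [show p + 3 - 1 = p + 2 by ring]) e.1
  have h2A : c (m + 2) ∉ B := fun e => hpre (m + 2) (by rwa [show m + 2 - 1 = m + 1 by ring]) e.1
  have aB : ∀ v ∈ B, ¬ G.Adj a v := by
    rintro v ⟨⟨q, hq, rfl⟩, -⟩ hav
    exact h.succ_notMem hq (h.nbr a ha _ hav)
  have a3 : ¬ G.Adj a (c (p + 3)) := fun e => hp3 (h.nbr a ha _ e)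
  have a2 : ¬ G.Adj a (c (m + 2)) := fun e => hX2 (h.nbr a ha _ e)
  have n3B : ∀ v ∈ B, ¬ G.Adj (c (p + 3)) v := by
    rintro v ⟨⟨q, hq, rfl⟩, hne⟩ hav
    obtain ⟨r, r1, r2, r3⟩ := h.cyc.exists_rep ⟨q, rfl⟩ p
    rw [← h.cyc.shift r3 1] at hav hne
    have := uniq r r1 r2 (r3 ▸ hq) hav
    subst this
    exact hne rfl
  have n2B : ∀ v ∈ B, ¬ G.Adj (c (m + 2)) v := by
    rintro v ⟨⟨q, hq, rfl⟩, hne⟩ hav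
    obtain ⟨r, r1, r2, r3⟩ := h.cyc.exists_rep ⟨q, rfl⟩ m
    rw [← h.cyc.shift r3 1] at hav hne
    rw [← r3] at hq
    have hrm : r ≠ m := by rintro rfl; exact hne rfl
    have : m' ≤ r := by
      by_contra hlt
      exact hm'.between r (by omega) (by omega) hq
    refine h.not_adj_pred_and_succ hm' (w := m + 1) (by omega) (by omega) hq this r2 ?_ ?_
    · rw [show m - 1 = p + 3 by omega]; exact h31.symm
    · rw [show m + 1 + 1 = m + 2 by ring]; exact hav
  -- If the next arc has length 3, both vertices precede attachments. Otherwise `c (m + 3)` is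
  -- adjacent to the first vertex after `m'`, and `not_adj_pred_and_succ` applies at `m + 2`.
  have n32 : ¬ G.Adj (c (p + 3)) (c (m + 2)) := by
    intro e
    rcases hmm'.eq_or_lt with e' | hlt
    · apply h.not_adj_pred hm.right hm'.right
      rw [show m - 1 = p + 3 by omega, show m' - 1 = m + 2 by omega]; exact e
    · refine h.not_adj_pred_and_succ hm' (w := m + 2) (by omega) (by omega) hm'.right le_rfl hN'
        ?_ ?_
      · rw [show m - 1 = p + 3 by omega]; exact e.symm
      · rw [show m + 2 + 1 = m + 3 by ring]
        exact (h.adj_next_first hm' (n := m + 3) (by omega) (by omega)).1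
  have nBB : ∀ u ∈ B, ∀ v ∈ B, ¬ G.Adj u v := by
    rintro u ⟨⟨q, hq, rfl⟩, -⟩ v ⟨⟨r, hr, rfl⟩, -⟩
    exact h.not_adj_succ hq hr
  have := h.indep (insert a (insert (c (p + 3)) (insert (c (m + 2)) B))) ?_
  · rw [Set.ncard_insert_of_notMem, Set.ncard_insert_of_notMem, Set.ncard_insert_of_notMem h2A]
      at this
    · omega
    · rintro (e | e)
      · exact h.cyc.ne_of_lt (by omega) (by omega) e
      · exact h3A e
    · rintro (e | e | e)
      · exact h.notMem _ (e ▸ ha)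
      · exact h.notMem _ (e ▸ ha)
      · obtain ⟨⟨q, -, rfl⟩, -⟩ := e
        exact h.notMem _ ha
  · rintro u (rfl | rfl | rfl | hu) v (rfl | rfl | rfl | hv)
    · exact G.loopless.irrefl _
    · exact a3
    · exact a2
    · exact aB v hv
    · exact fun e => a3 e.symm
    · exact G.loopless.irrefl _
    · exact n32
    · exact n3B v hv
    · exact fun e => a2 e.symm
    · exact fun e => n32 e.symm
    · exact G.loopless.irrefl _
    · exact n2B v hv
    · exact fun e => aB u hu e.symm
    · exact fun e => n3B u hu e.symm
    · exact fun e => n2B u hu e.symm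
    · exact nBB u hu v hv

lemma card_le [Finite V] (h : Obstruction G c N H X) : N ≤ 3 * X.ncard := by
  classical
  -- Each attachment pays for itself, its successor and one more vertex: the second vertex of its
  -- own arc, or, if that arc is too short to have one, the last vertex of the preceding arc. The
  -- latter pays for the third inner vertex of a long arc.
  let g : V → V := fun v => if c (Function.invFun c v + 2) ∈ X then c (Function.invFun c v - 1)
    else c (Function.invFun c v + 2)
  have hg : ∀ n, g (c n) = if c (n + 2) ∈ X then c (n - 1) else c (n + 2) := by
    intro n
    have e : c (Function.invFun c (c n)) = c n := Function.invFun_eq ⟨n, rfl⟩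
    simp only [g, sub_eq_add_neg, h.cyc.shift e]
  set A := {v | ∃ q, c q ∈ X ∧ c (q + 1) = v} with hA
  have hsub : Set.range c ⊆ X ∪ A ∪ g '' X := by
    rintro _ ⟨n, rfl⟩
    obtain ⟨x, hx, -⟩ := h.two
    obtain ⟨q, hq1, hq2, rfl⟩ := h.cyc.exists_rep (h.sub hx) (n - N + 1)
    obtain ⟨p, ⟨hp1, hp2⟩, hmax⟩ := Int.exists_greatest_of_bdd
      (P := fun s => s ≤ n ∧ c s ∈ X) ⟨n, fun z hz => hz.1⟩ ⟨q, by omega, hx⟩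
    obtain ⟨m, hm⟩ := h.exists_next hp2
    have h4 := h.arc_le hm
    have hlt := hm.lt
    have hnm : n < m := by
      by_contra hle
      have := hmax m ⟨by omega, hm.right⟩
      omega
    obtain rfl | rfl | rfl | rfl : n = p ∨ n = p + 1 ∨ n = p + 2 ∨ n = p + 3 := by omega
    · exact .inl (.inl hp2)
    · exact .inl (.inr ⟨p, hp2, rfl⟩)
    · refine .inr ⟨c p, hp2, ?_⟩
      rw [hg, if_neg (hm.between _ (by omega) hnm)]
    · refine .inr ⟨c m, hm.right, ?_⟩
      rw [hg, if_pos (h.next_arc_of_long hm (by omega))]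
      congr 1; omega
  have h1 := Set.ncard_le_ncard hsub
  have h2 := Set.ncard_union_le (X ∪ A) (g '' X)
  have h3 := Set.ncard_union_le X A
  have h4 := Set.ncard_image_le (f := g) (Set.toFinite X)
  rw [h.cyc.ncard_range] at h1
  rw [h.cyc.ncard_shift h.sub 1] at h3
  omega

end Obstruction

/-! ### Path-connected sets, components and cliques -/

/-- `K` is nonempty and any two of its vertices are joined by a path within `K`. -/
structure PathConn (G : SimpleGraph V) (K : Set V) : Prop where
  nonempty : K.Nonempty
  path : ∀ u ∈ K, ∀ v ∈ K, ∃ S ⊆ K, PathOn G u v S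

namespace PathConn

variable {K : Set V}

lemma singleton (u : V) : PathConn G {u} where
  nonempty := ⟨u, rfl⟩
  path := by
    rintro _ rfl _ rfl
    exact ⟨_, le_rfl, PathOn.single _⟩

lemma insert (h : PathConn G K) {a b : V} (ha : a ∉ K) (hb : b ∈ K) (hab : G.Adj a b) :
    PathConn G (insert a K) where
  nonempty := ⟨a, .inl rfl⟩
  path := by
    have key : ∀ v ∈ K, ∃ S ⊆ Insert.insert a K, PathOn G a v S := by
      intro v hv
      obtain ⟨S, hS, hp⟩ := h.path b hb v hv
      refine ⟨{a} ∪ S, ?_, (PathOn.single a).append hab hp ?_⟩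
      · exact Set.union_subset (by simp) (hS.trans (Set.subset_insert _ _))
      · rw [Set.disjoint_singleton_left]; exact fun e => ha (hS e)
    rintro u (rfl | hu) v (rfl | hv)
    · exact ⟨_, Set.singleton_subset_iff.2 (.inl rfl), PathOn.single _⟩
    · exact key v hv
    · obtain ⟨S, hS, hp⟩ := key u hu
      exact ⟨S, hS, hp.symm⟩
    · obtain ⟨S, hS, hp⟩ := h.path u hu v hv
      exact ⟨S, hS.trans (Set.subset_insert _ _), hp⟩

lemma conn (h : PathConn G K) {x y a b : V} (ha : a ∈ K) (hb : b ∈ K) (hxa : G.Adj x a)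
    (hby : G.Adj b y) : ∃ S ⊆ K, Conn G x y S := by
  obtain ⟨S, hS, hp⟩ := h.path a ha b hb
  exact ⟨S, hS, a, b, hxa, hp, hby⟩

/-- A connected component of the subgraph induced on `U`. -/
lemma exists_component [Finite V] {U : Set V} {u : V} (hu : u ∈ U) :
    ∃ K ⊆ U, u ∈ K ∧ PathConn G K ∧ ∀ a ∈ K, ∀ b ∈ U, G.Adj a b → b ∈ K := by
  obtain ⟨K, hK⟩ := (Set.toFinite {K : Set V | K ⊆ U ∧ u ∈ K ∧ PathConn G K}).exists_maximal
    ⟨{u}, by simpa using hu, rfl, singleton u⟩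
  obtain ⟨⟨h1, h2, h3⟩, hmax⟩ := hK
  refine ⟨K, h1, h2, h3, fun a ha b hb hab => ?_⟩
  by_contra hbK
  have := hmax (y := Insert.insert b K)
    ⟨Set.insert_subset hb h1, .inr h2, h3.insert hbK ha hab.symm⟩ (Set.subset_insert _ _)
  exact hbK (this (.inl rfl))

end PathConn

/-- A set of at least three pairwise adjacent vertices is the vertex set of a cycle. -/
lemma cycleOn_of_clique [Finite V] {S : Set V} (hS : ∀ u ∈ S, ∀ v ∈ S, u ≠ v → G.Adj u v)
    (h3 : 3 ≤ S.ncard) : CycleOn G S := by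
  obtain ⟨a, b, d, ha, hb, hd, hab, had, hbd⟩ := (Set.two_lt_ncard_iff (Set.toFinite S)).1 h3
  have hl : ∀ x, x ∈ (Set.toFinite S).toFinset.toList ↔ x ∈ S := by simp
  have hnd : (Set.toFinite S).toFinset.toList.Nodup := Finset.nodup_toList _
  generalize (Set.toFinite S).toFinset.toList = l at hl hnd
  have hne : l ≠ [] := by rintro rfl; simpa using (hl a).2 ha
  have hpw : l.IsChain G.Adj := by
    apply List.Pairwise.isChain
    refine List.Pairwise.imp_of_mem ?_ hnd
    intro x y hx hy hxy
    exact hS x ((hl x).1 hx) y ((hl y).1 hy) hxy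
  have hp : PathOn G (l.head hne) (l.getLast hne) S :=
    ⟨l, hpw, hnd, List.head?_eq_some_head hne, List.getLast?_eq_some_getLast hne, hl⟩
  refine hp.close ?_ ⟨a, ha, b, hb, d, hd, hab, had, hbd⟩
  refine hS _ ((hl _).1 (List.getLast_mem hne)) _ ((hl _).1 (List.head_mem hne)) ?_
  intro e
  have : 3 ≤ l.length := by
    have : [a, b, d].Subperm l := by
      apply List.subperm_of_subset
      · simp [hab, had, hbd]
      · intro x hx
        simp only [List.mem_cons, List.not_mem_nil, or_false] at hx
        rcases hx with rfl | rfl | rfl <;> simpa [hl]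
    simpa using this.length_le
  rw [List.getLast_eq_getElem, List.head_eq_getElem, hnd.getElem_inj_iff] at e
  omega

/-! ### Double detours and detours that release a vertex of the cycle -/

namespace IsCyc

variable {c : ℤ → V} {N : ℕ}

/-- A cycle with two vertices joined by one connecting path and their successors by another. -/
lemma cycleOn_two_conn (hc : IsCyc G c N) {p q : ℤ} (hpq : p < q) (hqp : q < p + N) {S T : Set V}
    (hS : ∀ m, c m ∉ S) (hT : ∀ m, c m ∉ T) (hST : Disjoint S T) (h : Conn G (c q) (c p) S)
    (h' : Conn G (c (q + 1)) (c (p + 1)) T) : CycleOn G (Set.range c ∪ S ∪ T) := by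
  have h3 := hc.three_le
  have hS' : ∀ s : Set ℤ, Disjoint (c '' s) S := fun s => by
    rw [Set.disjoint_left]
    rintro _ ⟨m, -, rfl⟩
    exact hS m
  have hT' : ∀ s : Set ℤ, Disjoint (c '' s) T := fun s => by
    rw [Set.disjoint_left]
    rintro _ ⟨m, -, rfl⟩
    exact hT m
  have s1 := hc.seg (i := p + 1) (j := q) (by omega) (by omega)
  have s2 := (hc.seg (i := q + 1) (j := p + N) (by omega) (by omega)).symm
  rw [hc.add_self] at s2
  have := h'.close (h.glue s1 s2 (hS' _) (hc.disj (by omega) (by omega)) (hS' _).symm)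
    (Set.disjoint_union_left.2 ⟨Set.disjoint_union_left.2 ⟨hT' _, hST⟩, hT' _⟩)
    ⟨_, .inl (.inl ⟨q, ⟨by omega, by omega⟩, rfl⟩), _, .inr ⟨q + 1, ⟨by omega, by omega⟩, rfl⟩,
      hc.ne_of_lt (by omega) (by omega)⟩
  convert this using 2
  rw [hc.range_eq (p + 1), Set.union_right_comm, ← Set.image_union]
  congr 2
  ext m
  simp only [Set.mem_Icc, Set.mem_union]
  omega

/-- Bypassing one vertex of a cycle through a connecting path. -/
lemma cycleOn_bypass (hc : IsCyc G c N) {p : ℤ} {S : Set V}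
    (hS : ∀ m, c m ∉ S) (h : Conn G (c p) (c (p + 2)) S) :
    CycleOn G (Set.range c \ {c (p + 1)} ∪ S) := by
  have h3 := hc.three_le
  have s1 := hc.seg (i := p + 2) (j := p + N) (by omega) (by omega)
  rw [hc.add_self] at s1
  have := h.close s1 (by
      rw [Set.disjoint_left]
      rintro _ ⟨m, -, rfl⟩
      exact hS m)
    ⟨_, ⟨p + 2, ⟨by omega, by omega⟩, rfl⟩, _, ⟨p + N, ⟨by omega, by omega⟩, rfl⟩,
      hc.ne_of_lt (by omega) (by omega)⟩
  convert this using 2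
  ext v
  constructor
  · rintro ⟨hv, hne⟩
    obtain ⟨n, h1, h2, rfl⟩ := hc.exists_rep hv (p + 1)
    have : n ≠ p + 1 := by rintro rfl; exact hne rfl
    exact ⟨n, ⟨by omega, by omega⟩, rfl⟩
  · rintro ⟨n, ⟨h1, h2⟩, rfl⟩
    exact ⟨⟨n, rfl⟩, (hc.ne_of_lt (by omega) (by omega)).symm⟩

/-- The crossing construction, leaving out the first of the two successors. -/
lemma cycleOn_cross_bypass (hc : IsCyc G c N) {p q : ℤ} (hpq : p + 2 ≤ q) (hqp : q < p + N)
    {S : Set V} (hS : ∀ m, c m ∉ S) (h : Conn G (c q) (c p) S)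
    (ha : G.Adj (c (q + 1)) (c (p + 2))) : CycleOn G (Set.range c \ {c (p + 1)} ∪ S) := by
  have h3 := hc.three_le
  have hS' : ∀ s : Set ℤ, Disjoint (c '' s) S := fun s => by
    rw [Set.disjoint_left]
    rintro _ ⟨m, -, rfl⟩
    exact hS m
  have s1 := hc.seg (i := p + 2) (j := q) (by omega) (by omega)
  have s2 := (hc.seg (i := q + 1) (j := p + N) (by omega) (by omega)).symm
  rw [hc.add_self] at s2
  have := (h.glue s1 s2 (hS' _) (hc.disj (by omega) (by omega)) (hS' _).symm).close ha ?_
  · convert this using 1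
    rw [Set.union_right_comm, ← Set.image_union]
    congr 1
    ext v
    constructor
    · rintro ⟨hv, hne⟩
      obtain ⟨n, h1, h2, rfl⟩ := hc.exists_rep hv (p + 1)
      have : n ≠ p + 1 := by rintro rfl; exact hne rfl
      refine ⟨n, ?_, rfl⟩
      simp only [Set.mem_Icc, Set.mem_union]
      omega
    · rintro ⟨n, hn, rfl⟩
      simp only [Set.mem_Icc, Set.mem_union] at hn
      exact ⟨⟨n, rfl⟩, (hc.ne_of_lt (by omega) (by omega)).symm⟩
  · obtain ⟨s, hs⟩ := h.nonempty
    refine ⟨c q, .inl (.inl ⟨q, ⟨by omega, le_rfl⟩, rfl⟩), s, .inl (.inr hs), c (q + 1),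
      .inr ⟨q + 1, ⟨le_rfl, by omega⟩, rfl⟩, ?_, hc.ne_of_lt (by omega) (by omega), ?_⟩
    · rintro rfl; exact hS _ hs
    · rintro rfl; exact hS _ hs

end IsCyc

/-! ### Components outside a longest cycle -/

/-- The vertices of the cycle `c` with a neighbour in `K`. -/
def attach (G : SimpleGraph V) (c : ℤ → V) (K : Set V) : Set V :=
  {v | v ∈ Set.range c ∧ ∃ a ∈ K, G.Adj a v}

/-- `c` is a longest cycle of `G` and `K` is a connected component of the rest of `G`; the
independent sets of `G` have at most `k + 1` elements and `G` is `k`-connected. -/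
structure LongestCycle (G : SimpleGraph V) (k : ℕ) (c : ℤ → V) (N : ℕ) (K : Set V) : Prop where
  cyc : IsCyc G c N
  max : ∀ S, CycleOn G S → S.ncard ≤ N
  conn : PathConn G K
  notMem : ∀ n, c n ∉ K
  closed : ∀ a ∈ K, ∀ b, G.Adj a b → b ∈ K ∨ b ∈ Set.range c
  indep : ∀ I : Set V, (∀ u ∈ I, ∀ v ∈ I, ¬ G.Adj u v) → I.ncard ≤ k + 1
  cut : ∀ A S : Set V, A.Nonempty → (∃ w, w ∉ A ∪ S) → Disjoint A S →
    (∀ a ∈ A, ∀ b, G.Adj a b → b ∈ A ∪ S) → k ≤ S.ncard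

namespace LongestCycle

variable {k : ℕ} {c : ℤ → V} {N : ℕ} {K : Set V}

/-- The arbitrary set `T` covers the use of two detours at once; it is empty when there is a single
detour. -/
lemma not_cycleOn_union [Finite V] (h : LongestCycle G k c N K) {S : Set V} (hS : S.Nonempty)
    (hd : ∀ m, c m ∉ S) {T : Set V} : ¬ CycleOn G (Set.range c ∪ S ∪ T) := by
  intro hC
  have h1 := h.max _ hC
  obtain ⟨s, hs⟩ := hS
  have : (Set.range c).ncard < (Set.range c ∪ S ∪ T).ncard := by
    apply Set.ncard_lt_ncard _ (Set.toFinite _)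
    refine ⟨fun x hx => .inl (.inl hx), fun hsub => ?_⟩
    obtain ⟨n, hn⟩ := hsub (.inl (.inr hs))
    exact hd n (hn ▸ hs)
  rw [h.cyc.ncard_range] at this
  omega

lemma exists_conn (h : LongestCycle G k c N K) {x y : V} (hx : x ∈ attach G c K)
    (hy : y ∈ attach G c K) : ∃ S ⊆ K, Conn G x y S := by
  obtain ⟨-, a, ha, hax⟩ := hx
  obtain ⟨-, b, hb, hby⟩ := hy
  exact h.conn.conn ha hb hax.symm hby

lemma notMem_of_subset (h : LongestCycle G k c N K) {S : Set V} (hS : S ⊆ K) (m : ℤ) : c m ∉ S :=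
  fun e => h.notMem m (hS e)

lemma succ_notMem [Finite V] (h : LongestCycle G k c N K) {n : ℤ} (hn : c n ∈ attach G c K) :
    c (n + 1) ∉ attach G c K := by
  intro hn'
  obtain ⟨S, hS, hc⟩ := h.exists_conn hn hn'
  have := h.cyc.cycleOn_insert (h.notMem_of_subset hS) hc
  rw [← Set.union_empty (_ ∪ _)] at this
  exact h.not_cycleOn_union hc.nonempty (h.notMem_of_subset hS) this

lemma not_adj_succ [Finite V] (h : LongestCycle G k c N K) {p q : ℤ} (hp : c p ∈ attach G c K)
    (hq : c q ∈ attach G c K) : ¬ G.Adj (c (p + 1)) (c (q + 1)) := by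
  intro ha
  obtain ⟨r, h1, h2, h3⟩ := h.cyc.exists_rep ⟨q, rfl⟩ p
  have e := h.cyc.shift h3 1
  rw [← e] at ha; rw [← h3] at hq
  rcases h1.eq_or_lt with rfl | h1
  · exact ha.ne rfl
  obtain ⟨S, hS, hc⟩ := h.exists_conn hq hp
  have := h.cyc.cycleOn_cross h1 h2 (h.notMem_of_subset hS) hc ha.symm
  rw [← Set.union_empty (_ ∪ _)] at this
  exact h.not_cycleOn_union hc.nonempty (h.notMem_of_subset hS) this

/-- The successors of the attachments of `K`. -/
def succs (G : SimpleGraph V) (c : ℤ → V) (K : Set V) : Set V :=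
  {v | ∃ q, c q ∈ attach G c K ∧ c (q + 1) = v}

lemma attach_sub : attach G c K ⊆ Set.range c := fun _ hx => hx.1

lemma ncard_succs (h : LongestCycle G k c N K) : (succs G c K).ncard = (attach G c K).ncard :=
  h.cyc.ncard_shift attach_sub 1

lemma not_adj_of_mem_succs [Finite V] (h : LongestCycle G k c N K) {a v : V} (ha : a ∈ K)
    (hv : v ∈ succs G c K) : ¬ G.Adj a v := by
  obtain ⟨q, hq, rfl⟩ := hv
  exact fun hav => h.succ_notMem hq ⟨⟨_, rfl⟩, a, ha, hav⟩

lemma not_adj_succs [Finite V] (h : LongestCycle G k c N K) {u v : V} (hu : u ∈ succs G c K)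
    (hv : v ∈ succs G c K) : ¬ G.Adj u v := by
  obtain ⟨p, hp, rfl⟩ := hu
  obtain ⟨q, hq, rfl⟩ := hv
  exact h.not_adj_succ hp hq

lemma mem_range_of_mem_succs {v : V} (hv : v ∈ succs G c K) : v ∈ Set.range c := by
  obtain ⟨q, -, rfl⟩ := hv
  exact ⟨_, rfl⟩

lemma notMem_succs (h : LongestCycle G k c N K) {a : V} (ha : a ∈ K) : a ∉ succs G c K := fun e =>
  by
    obtain ⟨n, rfl⟩ := mem_range_of_mem_succs e
    exact h.notMem n ha

/-- The attachments separate `K` from a vertex of the cycle: the successor of an attachment, or any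
vertex if there are no attachments. -/
lemma le_ncard_attach [Finite V] (h : LongestCycle G k c N K) : k ≤ (attach G c K).ncard := by
  refine h.cut K _ h.conn.nonempty ?_ ?_ ?_
  · by_cases hX : ∃ n, c n ∈ attach G c K
    · obtain ⟨n, hn⟩ := hX
      exact ⟨c (n + 1), fun e => e.elim (h.notMem _) (h.succ_notMem hn)⟩
    · push Not at hX
      exact ⟨c 0, fun e => e.elim (h.notMem _) (hX 0)⟩
  · rw [Set.disjoint_left]
    rintro a ha ⟨⟨n, rfl⟩, -⟩
    exact h.notMem n ha
  · intro a ha b hab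
    exact (h.closed a ha b hab).imp id fun hb => ⟨hb, a, ha, hab⟩

/-- A vertex of `K` together with the successors of its attachments is independent, which gives the
upper bound. -/
lemma ncard_attach [Finite V] (h : LongestCycle G k c N K) : (attach G c K).ncard = k := by
  refine le_antisymm ?_ h.le_ncard_attach
  obtain ⟨a, ha⟩ := h.conn.nonempty
  have := h.indep (insert a (succs G c K)) ?_
  · rw [Set.ncard_insert_of_notMem (h.notMem_succs ha), h.ncard_succs] at this
    omega
  · rintro u (rfl | hu) v (rfl | hv)
    · exact G.loopless.irrefl _
    · exact h.not_adj_of_mem_succs ha hv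
    · exact fun e => h.not_adj_of_mem_succs ha hu e.symm
    · exact h.not_adj_succs hu hv

lemma adj_of_mem [Finite V] (h : LongestCycle G k c N K) {a b : V} (ha : a ∈ K) (hb : b ∈ K)
    (hab : a ≠ b) : G.Adj a b := by
  by_contra hnot
  have := h.indep (insert a (insert b (succs G c K))) ?_
  · rw [Set.ncard_insert_of_notMem, Set.ncard_insert_of_notMem (h.notMem_succs hb), h.ncard_succs,
      h.ncard_attach] at this
    · omega
    · exact fun e => e.elim hab (h.notMem_succs ha)
  · rintro u (rfl | rfl | hu) v (rfl | rfl | hv)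
    · exact G.loopless.irrefl _
    · exact hnot
    · exact h.not_adj_of_mem_succs ha hv
    · exact fun e => hnot e.symm
    · exact G.loopless.irrefl _
    · exact h.not_adj_of_mem_succs hb hv
    · exact fun e => h.not_adj_of_mem_succs ha hu e.symm
    · exact fun e => h.not_adj_of_mem_succs hb hu e.symm
    · exact h.not_adj_succs hu hv

/-- If `G` has two components outside a longest cycle, then one of them can be enlarged by a
vertex of the cycle, leaving room for another longest cycle. -/
lemma exists_larger [Finite V] {L : Set V} (h : LongestCycle G k c N K)
    (h' : LongestCycle G k c N L) (hKL : Disjoint K L) :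
    ∃ c' a, IsCyc G c' N ∧ a ∉ K ∧ PathConn G (insert a K) ∧ ∀ n, c' n ∉ insert a K := by
  have h3 := h.cyc.three_le
  have sep : ∀ a ∈ K, ∀ b ∈ L, ¬ G.Adj a b := by
    intro a ha b hb hab
    rcases h.closed a ha b hab with hbK | ⟨n, rfl⟩
    · exact Set.disjoint_left.1 hKL hbK hb
    · exact h'.notMem n hb
  obtain ⟨a, ha⟩ := h.conn.nonempty
  obtain ⟨b, hb⟩ := h'.conn.nonempty
  have hab : a ≠ b := by rintro rfl; exact Set.disjoint_left.1 hKL ha hb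
  have haL : a ∉ succs G c L := by
    intro e
    obtain ⟨n, rfl⟩ := mem_range_of_mem_succs e
    exact h.notMem n ha
  -- Otherwise `a`, `b` and the `k` successors of attachments of `L` would be independent.
  obtain ⟨p, hp, hpa⟩ : ∃ p, c p ∈ attach G c L ∧ G.Adj a (c (p + 1)) := by
    by_contra! hcon
    have hcon' : ∀ v ∈ succs G c L, ¬ G.Adj a v := by
      rintro v ⟨q, hq, rfl⟩; exact hcon q hq
    have := h.indep (insert a (insert b (succs G c L))) ?_
    · rw [Set.ncard_insert_of_notMem, Set.ncard_insert_of_notMem (h'.notMem_succs hb),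
        h'.ncard_succs, h'.ncard_attach] at this
      · omega
      · exact fun e => e.elim hab haL
    · rintro u (rfl | rfl | hu) v (rfl | rfl | hv)
      · exact G.loopless.irrefl _
      · exact sep _ ha _ hb
      · exact hcon' v hv
      · exact fun e => sep _ ha _ hb e.symm
      · exact G.loopless.irrefl _
      · exact h'.not_adj_of_mem_succs hb hv
      · exact fun e => hcon' u hu e.symm
      · exact fun e => h'.not_adj_of_mem_succs hb hu e.symm
      · exact h'.not_adj_succs hu hv
  have hpK : c (p + 1) ∈ attach G c K := ⟨⟨_, rfl⟩, a, ha, hpa⟩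
  have hzK : c (p + 2) ∉ attach G c K := by
    have := h.succ_notMem hpK
    rwa [add_assoc] at this
  -- A second such position would allow two disjoint detours, through `L` between the attachments
  -- and through `K` between their successors, giving a longer cycle.
  have uniq : ∀ q, p < q → q < p + N → c q ∈ attach G c L → c (q + 1) ∉ attach G c K := by
    intro q hq1 hq2 hq hqK
    obtain ⟨S, hS, hcS⟩ := h'.exists_conn hq hp
    obtain ⟨T, hT, hcT⟩ := h.exists_conn hqK hpK
    refine h.not_cycleOn_union hcS.nonempty (h'.notMem_of_subset hS)
      (h.cyc.cycleOn_two_conn hq1 hq2 (h'.notMem_of_subset hS) (h.notMem_of_subset hT) ?_ hcS hcT)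
    exact (hKL.mono hT hS).symm
  -- A detour through `L` replacing only `c (p + 1)` cannot shorten the cycle, so by maximality it
  -- keeps its length; the released vertex then joins `K`.
  have finish : ∀ S ⊆ L, S.Nonempty → CycleOn G (Set.range c \ {c (p + 1)} ∪ S) →
      ∃ c' a, IsCyc G c' N ∧ a ∉ K ∧ PathConn G (insert a K) ∧ ∀ n, c' n ∉ insert a K := by
    intro S hS hSne hC
    have hmax := h.max _ hC
    obtain ⟨c', N', hc', hr⟩ := hC
    have hcard : (Set.range c \ {c (p + 1)} ∪ S).ncard = N - 1 + S.ncard := by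
      rw [Set.ncard_union_eq, Set.ncard_sdiff_singleton_of_mem (Set.mem_range_self _), h.cyc.ncard_range]
      rw [Set.disjoint_left]
      rintro _ ⟨⟨n, rfl⟩, -⟩ e
      exact h'.notMem n (hS e)
    have hSpos := (Set.ncard_pos (Set.toFinite S)).2 hSne
    have hN' : N' = N := by
      have := hc'.ncard_range
      rw [hr] at this
      omega
    subst hN'
    refine ⟨c', c (p + 1), hc', h.notMem _, h.conn.insert (h.notMem _) ha hpa.symm, ?_⟩
    intro n
    have hn : c' n ∈ Set.range c \ {c (p + 1)} ∪ S := hr ▸ ⟨n, rfl⟩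
    rintro (e | e)
    · rcases hn with hn | hn
      · exact hn.2 e
      · exact h'.notMem _ (hS (e ▸ hn))
    · rcases hn with ⟨⟨m, hm⟩, -⟩ | hn
      · exact h.notMem m (hm ▸ e)
      · exact Set.disjoint_left.1 hKL e (hS hn)
  have hp1 : c (p + 1) ∉ attach G c L := h'.succ_notMem hp
  have hzL : c (p + 2) ∉ succs G c L := by
    rintro ⟨q, hq, e⟩
    have := h.cyc.shift e (-1)
    apply hp1
    rw [show p + 1 = p + 2 + -1 by ring, ← this]
    simpa using hq
  by_cases hz : c (p + 2) ∈ attach G c L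
  · obtain ⟨S, hS, hcS⟩ := h'.exists_conn hp hz
    exact finish S hS hcS.nonempty (h.cyc.cycleOn_bypass (h'.notMem_of_subset hS) hcS)
  by_cases hzq : ∃ q, c q ∈ attach G c L ∧ G.Adj (c (p + 2)) (c (q + 1)) ∧ p < q ∧ q < p + N
  · obtain ⟨q, hq, hadj, hq1, hq2⟩ := hzq
    have hq3 : q ≠ p + 1 := by rintro rfl; exact hp1 hq
    obtain ⟨S, hS, hcS⟩ := h'.exists_conn hq hp
    exact finish S hS hcS.nonempty (h.cyc.cycleOn_cross_bypass (by omega) hq2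
      (h'.notMem_of_subset hS) hcS hadj.symm)
  exfalso
  -- If `c (p + 2)` allows neither detour, then `a`, `b`, `c (p + 2)` and the other `k - 1`
  -- successors are `k + 2` independent vertices.
  set B := succs G c L \ {c (p + 1)} with hB
  have hBcard : B.ncard + 1 = k := by
    rw [← h'.ncard_attach, ← h'.ncard_succs]
    exact Set.ncard_sdiff_singleton_add_one ⟨p, hp, rfl⟩
  have hBrep : ∀ v ∈ B, ∃ q, p < q ∧ q < p + N ∧ c q ∈ attach G c L ∧ c (q + 1) = v := by
    rintro v ⟨⟨q, hq, rfl⟩, hne⟩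
    obtain ⟨r, r1, r2, r3⟩ := h.cyc.exists_rep ⟨q, rfl⟩ p
    have e := h.cyc.shift r3 1
    refine ⟨r, ?_, r2, r3 ▸ hq, e⟩
    rcases r1.eq_or_lt with rfl | r1
    · exact absurd e.symm hne
    · exact r1
  have aB : ∀ v ∈ B, ¬ G.Adj a v := by
    intro v hv hav
    obtain ⟨q, q1, q2, hq, rfl⟩ := hBrep v hv
    exact uniq q q1 q2 hq ⟨⟨_, rfl⟩, a, ha, hav⟩
  have zB : ∀ v ∈ B, ¬ G.Adj (c (p + 2)) v := by
    intro v hv hzv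
    obtain ⟨q, q1, q2, hq, rfl⟩ := hBrep v hv
    exact hzq ⟨q, hq, hzv, q1, q2⟩
  have za : ¬ G.Adj a (c (p + 2)) := fun e => hzK ⟨⟨_, rfl⟩, a, ha, e⟩
  have zb : ¬ G.Adj b (c (p + 2)) := fun e => hz ⟨⟨_, rfl⟩, b, hb, e⟩
  have := h.indep (insert a (insert b (insert (c (p + 2)) B))) ?_
  · rw [Set.ncard_insert_of_notMem, Set.ncard_insert_of_notMem, Set.ncard_insert_of_notMem] at this
    · omega
    · exact fun e => hzL e.1
    · rintro (e | e)
      · exact h'.notMem _ (e ▸ hb)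
      · exact h'.notMem_succs hb e.1
    · rintro (e | e | e)
      · exact hab e
      · exact h.notMem _ (e ▸ ha)
      · exact haL e.1
  · have bB : ∀ v ∈ B, ¬ G.Adj b v := fun v hv => h'.not_adj_of_mem_succs hb hv.1
    rintro u (rfl | rfl | rfl | hu) v (rfl | rfl | rfl | hv)
    · exact G.loopless.irrefl _
    · exact sep _ ha _ hb
    · exact za
    · exact aB v hv
    · exact fun e => sep _ ha _ hb e.symm
    · exact G.loopless.irrefl _
    · exact zb
    · exact bB v hv
    · exact fun e => za e.symm
    · exact fun e => zb e.symm
    · exact G.loopless.irrefl _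
    · exact zB v hv
    · exact fun e => aB u hu e.symm
    · exact fun e => bB u hu e.symm
    · exact fun e => zB u hu e.symm
    · exact h'.not_adj_succs hu.1 hv.1

end LongestCycle

/-! ### The extremal choice and the final count -/

/-- A graph with independent sets of at most `k + 1` vertices that is `k`-connected, has minimum
degree at least two and at least `3 * k + 3` vertices is covered by at most two disjoint cycles. -/
theorem exists_cycles_cover [Finite V] {k : ℕ} (hk : 1 ≤ k) (hn : 3 * k + 3 ≤ Nat.card V)
    (hdeg : ∀ v, ∃ x y, x ≠ y ∧ G.Adj v x ∧ G.Adj v y)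
    (indep : ∀ I : Set V, (∀ u ∈ I, ∀ v ∈ I, ¬ G.Adj u v) → I.ncard ≤ k + 1)
    (cut : ∀ A S : Set V, A.Nonempty → (∃ w, w ∉ A ∪ S) → Disjoint A S →
      (∀ a ∈ A, ∀ b, G.Adj a b → b ∈ A ∪ S) → k ≤ S.ncard)
    (hcyc : ∃ S, CycleOn G S) :
    CycleOn G Set.univ ∨
      ∃ S T, CycleOn G S ∧ CycleOn G T ∧ Disjoint S T ∧ S ∪ T = Set.univ := by
  by_contra! hcon
  obtain ⟨ham, two⟩ := hcon
  obtain ⟨R, ⟨c₀, N, hc₀, rfl⟩, hRmax⟩ :=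
    Set.exists_max_image {S | CycleOn G S} Set.ncard (Set.toFinite _) hcyc
  rw [hc₀.ncard_range] at hRmax
  have room : ∀ c, IsCyc G c N → ∃ u, u ∉ Set.range c := by
    intro c hc
    by_contra! hall
    exact ham ⟨c, N, hc, Set.eq_univ_of_forall hall⟩
  obtain ⟨u₀, hu₀⟩ := room c₀ hc₀
  -- The cycle is chosen again here: `H` is largest over all cycles of the maximal length `N`, since
  -- enlarging a component may change the cycle.
  obtain ⟨H, ⟨hH, c, hc, hdisj⟩, hHmax⟩ :=
    Set.exists_max_image {H | PathConn G H ∧ ∃ c, IsCyc G c N ∧ ∀ n, c n ∉ H} Set.ncard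
      (Set.toFinite _) ⟨{u₀}, PathConn.singleton u₀, c₀, hc₀, fun n e => hu₀ ⟨n, e⟩⟩
  have big : ∀ c' a, IsCyc G c' N → a ∉ H → PathConn G (insert a H) →
      ¬ ∀ n, c' n ∉ insert a H := by
    intro c' a hc' ha hp hd
    have := hHmax _ ⟨hp, c', hc', hd⟩
    rw [Set.ncard_insert_of_notMem ha] at this
    omega
  have hclosed : ∀ a ∈ H, ∀ b, G.Adj a b → b ∈ H ∨ b ∈ Set.range c := by
    intro a ha b hab
    by_contra! hb
    refine big c b hc hb.1 (hH.insert hb.1 ha hab.symm) ?_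
    rintro n (e | e)
    · exact hb.2 ⟨n, e⟩
    · exact hdisj n e
  have L : LongestCycle G k c N H := ⟨hc, hRmax, hH, hdisj, hclosed, indep, cut⟩
  have cover : ∀ v, v ∈ H ∨ v ∈ Set.range c := by
    by_contra! hex
    obtain ⟨v, hv1, hv2⟩ := hex
    obtain ⟨K, hKU, -, hK, hKcl⟩ := PathConn.exists_component (G := G)
      (U := (H ∪ Set.range c)ᶜ) (u := v) (fun e => e.elim hv1 hv2)
    have hHK : Disjoint H K := by
      rw [Set.disjoint_left]
      exact fun a ha haK => hKU haK (.inl ha)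
    have L' : LongestCycle G k c N K := by
      refine ⟨hc, hRmax, hK, fun n e => hKU e (.inr ⟨n, rfl⟩), ?_, indep, cut⟩
      intro a ha b hab
      by_cases hb : b ∈ Set.range c
      · exact .inr hb
      refine .inl (hKcl a ha b ?_ hab)
      rintro (e | e)
      · exact (hclosed b e a hab.symm).elim (fun e' => hKU ha (.inl e'))
          (fun e' => hKU ha (.inr e'))
      · exact hb e
    obtain ⟨c', a, h1, h2, h3, h4⟩ := L.exists_larger L' hHK
    exact big c' a h1 h2 h3 h4
  have hdis : Disjoint (Set.range c) H := by
    rw [Set.disjoint_left]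
    rintro _ ⟨n, rfl⟩
    exact hdisj n
  have hun : Set.range c ∪ H = Set.univ := Set.eq_univ_of_forall fun v => (cover v).symm
  have hcard : N + H.ncard = Nat.card V := by
    rw [← hc.ncard_range, ← Set.ncard_union_eq hdis, hun, Set.ncard_univ]
  have hHsmall : H.ncard ≤ 2 := by
    by_contra! h3
    exact two _ _ ⟨c, N, hc, rfl⟩ (cycleOn_of_clique (fun a ha b hb => L.adj_of_mem ha hb) h3)
      hdis hun
  have hXcard := L.ncard_attach
  have nbr : ∀ a ∈ H, ∀ v, v ∉ H → G.Adj a v → v ∈ attach G c H := fun a ha v hv hav =>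
    ⟨(hclosed a ha v hav).resolve_left hv, a, ha, hav⟩
  have hHpos := (Set.ncard_pos (Set.toFinite H)).2 hH.nonempty
  have hXH : ∀ x ∈ attach G c H, x ∉ H := by
    rintro x ⟨⟨n, rfl⟩, -⟩; exact hdisj n
  -- A single attachment leaves no pair to reroute between, so `k = 1` is treated separately.
  rcases hk.eq_or_lt with rfl | hk2
  · obtain ⟨x, hx⟩ := Set.ncard_eq_one.1 hXcard
    have hxX : x ∈ attach G c H := hx ▸ rfl
    obtain hH1 | hH2 : H.ncard = 1 ∨ H.ncard = 2 := by omega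
    · obtain ⟨a, rfl⟩ := Set.ncard_eq_one.1 hH1
      obtain ⟨y, z, hyz, hy, hz⟩ := hdeg a
      have hy' := nbr a rfl y (fun e => hy.ne e.symm) hy
      have hz' := nbr a rfl z (fun e => hz.ne e.symm) hz
      rw [hx] at hy' hz'
      exact hyz (hy'.trans hz'.symm)
    · obtain ⟨a, b, hab, rfl⟩ := Set.ncard_eq_two.1 hH2
      have hadj : ∀ u ∈ ({a, b} : Set V), G.Adj u x := by
        intro u hu
        obtain ⟨y, z, hyz, hy, hz⟩ := hdeg u
        by_contra hux
        have hout : ∀ v, G.Adj u v → v ∈ ({a, b} : Set V) := by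
          intro v huv
          by_contra hv
          have := nbr u hu v hv huv
          rw [hx] at this
          exact hux (this ▸ huv)
        rcases hu with rfl | rfl
        · rcases hout y hy with rfl | rfl
          · exact hy.ne rfl
          · rcases hout z hz with rfl | rfl
            · exact hz.ne rfl
            · exact hyz rfl
        · rcases hout y hy with rfl | rfl
          · rcases hout z hz with rfl | rfl
            · exact hyz rfl
            · exact hz.ne rfl
          · exact hy.ne rfl
      have hxab := hXH x hxX
      have C1 : CycleOn G (insert x {a, b}) := by
        refine cycleOn_of_clique ?_ (by rw [Set.ncard_insert_of_notMem hxab]; omega)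
        rintro u (rfl | hu) v (rfl | hv) huv
        · exact absurd rfl huv
        · exact (hadj v hv).symm
        · exact hadj u hu
        · exact L.adj_of_mem hu hv huv
      have C2 : CycleOn G (Set.range c \ {x}) := by
        refine cycleOn_of_clique ?_ ?_
        · rintro u ⟨hu, hux⟩ v ⟨hv, hvx⟩ huv
          by_contra hnot
          have hau : ¬ G.Adj a u := fun e => hux <| by
            have : u ∈ attach G c {a, b} := ⟨hu, a, .inl rfl, e⟩
            rwa [hx] at this
          have hav : ¬ G.Adj a v := fun e => hvx <| by
            have : v ∈ attach G c {a, b} := ⟨hv, a, .inl rfl, e⟩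
            rwa [hx] at this
          have := indep {a, u, v} ?_
          · rw [Set.ncard_insert_of_notMem, Set.ncard_pair huv] at this
            · omega
            · rintro (rfl | rfl)
              · exact Set.disjoint_left.1 hdis hu (.inl rfl)
              · exact Set.disjoint_left.1 hdis hv (.inl rfl)
          · rintro s (rfl | rfl | rfl) t (rfl | rfl | rfl) <;>
              first
              | exact G.loopless.irrefl _
              | assumption
              | exact fun e => hau e.symm
              | exact fun e => hav e.symm
              | exact fun e => hnot e.symm
        · rw [Set.ncard_sdiff_singleton_of_mem hxX.1, hc.ncard_range]
          omega
      refine two _ _ C2 C1 ?_ (Set.eq_univ_of_forall fun v => ?_)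
      · rw [Set.disjoint_left]
        rintro v ⟨hv, hvx⟩ (e | e)
        · exact hvx e
        · exact Set.disjoint_left.1 hdis hv e
      · by_cases hvx : v = x
        · exact .inr (.inl hvx)
        · exact (cover v).elim (fun e => .inr (.inr e)) (fun e => .inl ⟨e, hvx⟩)
  · have hconn : ∀ x ∈ attach G c H, ∀ y ∈ attach G c H, x ≠ y → Conn G x y H := by
      intro x hx y hy hxy
      obtain hH1 | hH2 : H.ncard = 1 ∨ H.ncard = 2 := by omega
      · obtain ⟨a, rfl⟩ := Set.ncard_eq_one.1 hH1
        obtain ⟨-, _, rfl, hax⟩ := hx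
        obtain ⟨-, _, rfl, hay⟩ := hy
        exact ⟨_, _, hax.symm, PathOn.single _, hay⟩
      · obtain ⟨a, b, hab, rfl⟩ := Set.ncard_eq_two.1 hH2
        have hadj : G.Adj a b := L.adj_of_mem (.inl rfl) (.inr rfl) hab
        have hp : PathOn G a b {a, b} :=
          (PathOn.single a).append hadj (PathOn.single b) (by simpa using hab)
        -- If `u` missed both `x` and `y`, then `v` and the other `k - 2` attachments would separate
        -- `u` from `x`, contradicting `k`-connectivity.
        have avoid : ∀ u ∈ ({a, b} : Set V), ∀ v ∈ ({a, b} : Set V), u ≠ v →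
            G.Adj u x ∨ G.Adj u y := by
          intro u hu v hv huv
          by_contra! hno
          have hS : ((attach G c {a, b} \ {x}) \ {y}).ncard + 2 = k := by
            have h1 := Set.ncard_sdiff_singleton_add_one hx
            have h2 := Set.ncard_sdiff_singleton_add_one (s := attach G c {a, b} \ {x}) (a := y)
              ⟨hy, fun e => hxy e.symm⟩
            omega
          have := cut {u} (insert v ((attach G c {a, b} \ {x}) \ {y})) ⟨u, rfl⟩ ⟨x, ?_⟩ ?_ ?_
          · have h1 := Set.ncard_insert_le v ((attach G c {a, b} \ {x}) \ {y})
            omega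
          · rintro (rfl | rfl | e)
            · exact hXH _ hx hu
            · exact hXH _ hx hv
            · exact e.1.2 rfl
          · rw [Set.disjoint_singleton_left]
            rintro (e | e)
            · exact huv e
            · exact hXH _ e.1.1 hu
          · rintro _ rfl t hut
            by_cases ht : t ∈ ({a, b} : Set V)
            · refine .inr (.inl ?_)
              have := hut.ne
              rcases hu with rfl | rfl <;> rcases hv with rfl | rfl <;> rcases ht with rfl | rfl <;>
                first | rfl | exact absurd rfl huv | exact absurd rfl this
            · refine .inr (.inr ⟨⟨nbr _ hu _ ht hut, ?_⟩, ?_⟩)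
              · rintro rfl; exact hno.1 hut
              · rintro rfl; exact hno.2 hut
        have key1 := avoid a (.inl rfl) b (.inr rfl) hab
        have key2 := avoid b (.inr rfl) a (.inl rfl) hab.symm
        have hx' : G.Adj a x ∨ G.Adj b x := by
          obtain ⟨-, u, rfl | rfl, h⟩ := hx
          · exact .inl h
          · exact .inr h
        have hy' : G.Adj a y ∨ G.Adj b y := by
          obtain ⟨-, u, rfl | rfl, h⟩ := hy
          · exact .inl h
          · exact .inr h
        -- Each of `a`, `b` sees one of `x`, `y`, and conversely, so the two pairs can be matched
        -- straight or crosswise.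
        by_cases h1 : G.Adj a x ∧ G.Adj b y
        · exact ⟨a, b, h1.1.symm, hp, h1.2⟩
        · have h2 : G.Adj b x ∧ G.Adj a y := by tauto
          exact ⟨b, a, h2.1.symm, hp.symm, h2.2⟩
    have O : Obstruction G c N H (attach G c H) := by
      refine ⟨hc, hdisj, cover, hH.nonempty, hconn, ?_, ?_, fun x hx => hx.1, two, ham, ?_⟩
      · exact fun a ha n han => ⟨⟨n, rfl⟩, a, ha, han⟩
      · exact (Set.one_lt_ncard_iff (Set.toFinite _)).1 (by omega) |>.imp fun x ⟨y, hx, hy, hxy⟩ =>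
          ⟨hx, y, hy, hxy⟩
      · rw [hXcard]; exact indep
    -- This gives `N ≤ 3 * k`, while at least `3 * k + 3` vertices with at most two in `H` force `N
    -- ≥ 3 * k + 1`.
    have := O.card_le
    omega

/-! ### From covering cycles to 2-factors, and the graph invariants -/

/-- Pairwise disjoint cycles covering the vertices form a 2-factor. -/
lemma exists_isTwoFactor {ι : Type*} [Finite ι] (c : ι → ℤ → V) (N : ι → ℕ)
    (hc : ∀ i, IsCyc G (c i) (N i))
    (hd : ∀ i j m n, c i m = c j n → i = j) (hcov : ∀ v, ∃ i n, c i n = v) :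
    ∃ F : SimpleGraph V, G.IsTwoFactor F ∧ Nat.card F.ConnectedComponent ≤ Nat.card ι := by
  let F : SimpleGraph V :=
    { Adj := fun u v => ∃ i n, (u = c i n ∧ v = c i (n + 1)) ∨ (v = c i n ∧ u = c i (n + 1))
      symm := ⟨fun u v ⟨i, n, h⟩ => ⟨i, n, h.symm⟩⟩
      loopless := ⟨fun u ⟨i, n, h⟩ => by
        rcases h with ⟨h1, h2⟩ | ⟨h1, h2⟩ <;> exact ((hc i).adj n).ne (h1.symm.trans h2)⟩ }
  have hnbr : ∀ i n, F.neighborSet (c i n) = {c i (n + 1), c i (n - 1)} := by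
    intro i n
    ext v
    simp only [mem_neighborSet, Set.mem_insert_iff, Set.mem_singleton_iff]
    constructor
    · rintro ⟨j, m, ⟨h1, rfl⟩ | ⟨rfl, h1⟩⟩
      · obtain rfl := hd _ _ _ _ h1
        exact .inl ((hc i).shift h1 1).symm
      · obtain rfl := hd _ _ _ _ h1
        have := (hc i).shift h1 (-1)
        right
        rw [sub_eq_add_neg, this]; simp
    · rintro (rfl | rfl)
      · exact ⟨i, n, .inl ⟨rfl, rfl⟩⟩
      · exact ⟨i, n - 1, .inr ⟨rfl, by simp⟩⟩
  refine ⟨F, ⟨?_, ?_⟩, ?_⟩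
  · rintro u v ⟨i, n, ⟨rfl, rfl⟩ | ⟨rfl, rfl⟩⟩
    · exact (hc i).adj n
    · exact ((hc i).adj n).symm
  · intro v
    obtain ⟨i, n, rfl⟩ := hcov v
    rw [hnbr]
    have := (hc i).three_le
    exact Set.ncard_pair ((hc i).ne_of_lt (by omega) (by omega)).symm
  · have hstep : ∀ i n, F.Reachable (c i n) (c i (n + 1)) := fun i n =>
      (show F.Adj _ _ from ⟨i, n, .inl ⟨rfl, rfl⟩⟩).reachable
    have hreach : ∀ i n, F.Reachable (c i 0) (c i n) := by
      intro i n
      induction n using Int.induction_on with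
      | zero => rfl
      | succ n ih => exact ih.trans (hstep i n)
      | pred n ih =>
        have := hstep i (-n - 1)
        rw [sub_add_cancel] at this
        exact ih.trans this.symm
    refine Nat.card_le_card_of_surjective (fun i => F.connectedComponentMk (c i 0)) ?_
    intro K
    induction K using ConnectedComponent.ind with
    | h v =>
      obtain ⟨i, n, rfl⟩ := hcov v
      exact ⟨i, ConnectedComponent.eq.2 (hreach i n)⟩

lemma Walk.IsCycle.cycleOn {v : V} {p : G.Walk v v} (hp : p.IsCycle) : ∃ S, CycleOn G S := by
  cases p with
  | nil => exact absurd rfl hp.ne_nil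
  | @cons _ w _ h q =>
    have h3 := hp.three_le_length
    have hq := (Walk.cons_isCycle_iff q h).1 hp
    have hnd := hq.1.support_nodup
    have hlen : 3 ≤ q.support.length := by
      rw [Walk.length_support]
      simpa using h3
    refine ⟨{x | x ∈ q.support}, PathOn.close (u := w) (v := v)
      ⟨q.support, q.isChain_adj_support, hnd, ?_, ?_, fun x => Iff.rfl⟩ h
      ⟨q.support[0], List.getElem_mem _, q.support[1], List.getElem_mem _, q.support[2],
        List.getElem_mem _, ?_, ?_, ?_⟩⟩
    · rw [List.head?_eq_some_head q.support_ne_nil, Walk.head_support]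
    · rw [List.getLast?_eq_some_getLast q.support_ne_nil, Walk.getLast_support]
    all_goals
      rw [Ne, hnd.getElem_inj_iff]
      omega

/-- A set of vertices separating two nonempty parts has at least `κ(G)` elements. -/
lemma vertexConnectivity_le_ncard [Finite V] {A S : Set V} (hA : A.Nonempty) (hw : ∃ w, w ∉ A ∪ S)
    (hd : Disjoint A S) (hcl : ∀ a ∈ A, ∀ b, G.Adj a b → b ∈ A ∪ S) :
    G.vertexConnectivity ≤ S.ncard := by
  refine Nat.sInf_le ⟨(Set.toFinite S).toFinset, (Set.ncard_eq_toFinset_card S).symm, .inl ?_⟩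
  intro hpre
  obtain ⟨a, ha⟩ := hA
  obtain ⟨w, hw⟩ := hw
  rw [Set.Finite.coe_toFinset] at hpre
  have key : ∀ u v : (Sᶜ : Set V), (G.induce Sᶜ).Walk u v → (u : V) ∈ A → (v : V) ∈ A := by
    intro u v p
    induction p with
    | nil => exact id
    | @cons x y z hxy _ ih =>
      intro hx
      exact ih ((hcl _ hx _ hxy).resolve_right y.2)
  obtain ⟨p⟩ := hpre ⟨a, Set.disjoint_left.1 hd ha⟩ ⟨w, fun e => hw (.inr e)⟩
  exact hw (.inl (key _ _ p ha))

lemma one_le_vertexConnectivity [Fintype V] (hconn : G.Connected) (hV : 2 ≤ Fintype.card V) :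
    1 ≤ G.vertexConnectivity := by
  by_contra! h0
  -- Removing all vertices is always allowed, so the infimum is attained and is not the default
  -- value of an empty set.
  have hmem := Nat.sInf_mem (s := {k : ℕ | ∃ S : Finset V, S.card = k ∧
    (¬ (G.induce ((S : Set V)ᶜ)).Preconnected ∨ ((S : Set V)ᶜ).Subsingleton)})
    ⟨_, Finset.univ, rfl, .inr (by simp)⟩
  obtain ⟨S, hS, h⟩ := hmem
  have : S = ∅ := by
    rw [← Finset.card_eq_zero, hS]
    exact Nat.lt_one_iff.1 h0
  subst this
  rcases h with h | h
  · apply h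
    rw [Finset.coe_empty, Set.compl_empty]
    exact (induceUnivIso G).symm.connected_iff.1 hconn |>.preconnected
  · rw [Finset.coe_empty, Set.compl_empty] at h
    obtain ⟨x, y, hxy⟩ := Fintype.exists_pair_of_one_lt_card (α := V) (by omega)
    exact hxy (h trivial trivial)

theorem exists_isTwoFactor_of_indepNum_le [Fintype V] (G : SimpleGraph V) [DecidableRel G.Adj]
    (hconn : G.Connected)
    (horder : 3 * G.vertexConnectivity + 3 ≤ Fintype.card V)
    (hdeg : 2 ≤ G.minDegree)
    (hindep : G.indepNum ≤ G.vertexConnectivity + 1) :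
    ∃ F : SimpleGraph V, G.IsTwoFactor F ∧ Nat.card F.ConnectedComponent ≤ 2 := by
  have hcyc : ∃ S, CycleOn G S := by
    by_contra hno
    -- A connected acyclic graph on at least two vertices has a leaf, against the degree condition.
    have hac : G.IsAcyclic := fun v p hp => hno hp.cycleOn
    have : Nontrivial V := Fintype.one_lt_card_iff_nontrivial.1 (by omega)
    have := IsTree.minDegree_eq_one_of_nontrivial (G := G) ⟨hconn, hac⟩
    omega
  have hdeg' : ∀ v, ∃ x y, x ≠ y ∧ G.Adj v x ∧ G.Adj v y := by
    intro v
    have h2 : 1 < (G.neighborFinset v).card := by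
      rw [card_neighborFinset_eq_degree]
      exact hdeg.trans (G.minDegree_le_degree v)
    obtain ⟨x, hx, y, hy, hxy⟩ := Finset.one_lt_card.1 h2
    exact ⟨x, y, hxy, by simpa using hx, by simpa using hy⟩
  have hind : ∀ I : Set V, (∀ u ∈ I, ∀ v ∈ I, ¬ G.Adj u v) →
      I.ncard ≤ G.vertexConnectivity + 1 := by
    intro I hI
    rw [Set.ncard_eq_toFinset_card I]
    refine le_trans (IsIndepSet.card_le_indepNum ?_) hindep
    intro u hu v hv _
    exact hI u (by simpa using hu) v (by simpa using hv)
  rcases exists_cycles_cover (one_le_vertexConnectivity hconn (by omega))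
    (by rwa [Nat.card_eq_fintype_card]) hdeg' hind
    (fun A S h1 h2 h3 h4 => vertexConnectivity_le_ncard h1 h2 h3 h4) hcyc with h | h
  · obtain ⟨c, N, hc, hr⟩ := h
    obtain ⟨F, hF, hF'⟩ := exists_isTwoFactor (ι := Unit) (fun _ => c) (fun _ => N) (fun _ => hc)
      (fun _ _ _ _ _ => rfl) fun v => ⟨(), by
        have : v ∈ Set.range c := hr ▸ trivial
        exact this⟩
    exact ⟨F, hF, hF'.trans (by simp)⟩
  · obtain ⟨S, T, ⟨c, N, hc, rfl⟩, ⟨d, M, hd, rfl⟩, hdis, hun⟩ := h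
    have hne : ∀ m n, c m ≠ d n := fun m n e =>
      Set.disjoint_left.1 hdis ⟨m, rfl⟩ ⟨n, e.symm⟩
    obtain ⟨F, hF, hF'⟩ := exists_isTwoFactor (ι := Bool) (fun b => if b then c else d)
      (fun b => if b then N else M) (by rintro (_ | _) <;> simpa)
      (by
        rintro (_ | _) (_ | _) m n e
        · rfl
        · exact absurd e.symm (hne _ _)
        · exact absurd e (hne _ _)
        · rfl)
      (by
        intro v
        have : v ∈ Set.range c ∪ Set.range d := hun ▸ trivial
        rcases this with ⟨n, hn⟩ | ⟨n, hn⟩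
        · exact ⟨true, n, hn⟩
        · exact ⟨false, n, hn⟩)
    exact ⟨F, hF, hF'.trans (by simp)⟩

end SimpleGraph

theorem corollary1p7 {V : Type*} [Fintype V] (G : SimpleGraph V) [DecidableRel G.Adj]
    (hconn : G.Connected)
    (horder : 3 * G.vertexConnectivity + 3 ≤ Fintype.card V)
    (hdeg : 2 ≤ G.minDegree)
    (hindep : G.indepNum ≤ G.vertexConnectivity + 1) :
    ∃ F : SimpleGraph V, G.IsTwoFactor F ∧ Nat.card F.ConnectedComponent ≤ 2 :=
  G.exists_isTwoFactor_of_indepNum_le hconn horder hdeg hindep
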